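/- Fix $c>0$. For each $N\ge 1$ let $w^{(N)}=(w_1,\dots,w_N)$ be a random vector with the symmetric Dirichlet distribution with all parameters equal to $c/N$, and let $\lambda^{(N)}=(\lambda_1,\dots,\lambda_N)$ be a vector of real random variables, defined on the same probability space and independent of $w^{(N)}$ (the probability space may depend on $N$; no assumption is made on the joint law of $\lambda_1,\dots,\lambda_N$). Let $$L_N=\frac1N\sum_{i=1}^N\delta_{\lambda_i},\qquad sp_N=\sum_{i=1}^N w_i\,\delta_{\lambda_i}.$$ Suppose that $L_N$ converges weakly, in probability, to a deterministic probability measure $\rho$ on $\mathbb R$, that is, $\int f\,dL_N\to\int f\,d\rho$ in probability as $N\to\infty$ for every bounded continuous $f\colon\mathbb R\to\mathbb R$. Then, as $N\to\infty$, the random probability measure $sp_N$ converges in distribution to a Dirichlet process with base distribution $\rho$ and scaling parameter $c$. That is, such a process exists, and for every such process $P$ the law of $sp_N$ converges weakly to the law of $P$ on the space $\mathcal P(\mathbb R)$ of Borel probability measures on $\mathbb R$ with the topology of weak convergence (in particular $\int f\,dsp_N\to\int f\,dP$ in distribution for every bounded continuous $f$). Here, for parameters $a_1,\dots,a_n\ge0$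 that are not all zero, the Dirichlet distribution $\mathrm{Dir}(a_1,\dots,a_n)$ is the law of $(g_1,\dots,g_n)/(g_1+\dots+g_n)$, where the $g_i$ are independent, $g_i$ has the Gamma distribution with shape $a_i$ and rate $1$ if $a_i>0$, and $g_i=0$ if $a_i=0$. A Dirichlet process with base distribution $\rho$ and scaling parameter $c$, written $\mathrm{DP}(\rho,c)$, is a random probability measure $P$ on $\mathbb R$ such that, for every finite measurable partition $\mathbb R=A_1\cup\dots\cup A_n$, the vector $(P(A_1),\dots,P(A_n))$ has the distribution $\mathrm{Dir}(c\rho(A_1),\dots,c\rho(A_n))$. -/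

import Mathlib

open MeasureTheory ProbabilityTheory Filter Topology
open scoped ENNReal NNReal

/-! ### The space of probability measures on the real line

`ProbabilityMeasure ℝ` carries the topology of weak convergence. Its measurable structure in Mathlib
is the one generated by the evaluations `ν ↦ ν A`, for `A` Borel. We check that this is the Borel
σ-algebra of the weak topology, so that a random probability measure is a measurable map into
`ProbabilityMeasure ℝ` in the Borel sense. -/

/-- A countable family of sets that generates the weak topology. -/
def weakSubbasis : Set (Set (ProbabilityMeasure ℝ)) :=
  (fun p : Set (Set ℝ) × ℚ =>
      {ν : ProbabilityMeasure ℝ | (Real.toNNReal p.2 : ℝ≥0∞) < (ν : Measure ℝ) (⋃₀ p.1)}) ''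
    ({F : Set (Set ℝ) | F.Finite ∧ F ⊆ TopologicalSpace.countableBasis ℝ} ×ˢ Set.univ)

theorem weakSubbasis_countable : weakSubbasis.Countable :=
  ((Set.countable_ofPred_finite_subset (TopologicalSpace.countable_countableBasis ℝ)).prod
    Set.countable_univ).image _

theorem isOpen_setOf_lt_probabilityMeasure {G : Set ℝ} (hG : IsOpen G) (a : ℝ≥0∞) :
    IsOpen {ν : ProbabilityMeasure ℝ | a < (ν : Measure ℝ) G} := by
  rw [isOpen_iff_mem_nhds]
  intro ν hν
  have h : a < liminf (fun η : ProbabilityMeasure ℝ => (η : Measure ℝ) G) (𝓝 ν) :=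
    lt_of_lt_of_le hν (ProbabilityMeasure.le_liminf_measure_open_of_tendsto tendsto_id hG)
  exact eventually_lt_of_lt_liminf h

theorem exists_finite_lt_measure_sUnion (ν : ProbabilityMeasure ℝ) {G : Set ℝ} (hG : IsOpen G)
    {a : ℝ≥0∞} (ha : a < (ν : Measure ℝ) G) :
    ∃ F : Set (Set ℝ), F.Finite ∧ F ⊆ TopologicalSpace.countableBasis ℝ ∧ ⋃₀ F ⊆ G ∧
      a < (ν : Measure ℝ) (⋃₀ F) := by
  set S : Set (Set ℝ) := {s ∈ TopologicalSpace.countableBasis ℝ | s ⊆ G} with hS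
  have hGS : G = ⋃₀ S := (TopologicalSpace.isBasis_countableBasis ℝ).open_eq_sUnion' hG
  obtain ⟨K, hKG, hK, haK⟩ := hG.exists_lt_isCompact ha
  have hSo : ∀ s : S, IsOpen (s : Set ℝ) := fun s =>
    TopologicalSpace.isOpen_of_mem_countableBasis s.2.1
  obtain ⟨T, hKT⟩ := hK.elim_finite_subcover (fun s : S => (s : Set ℝ)) hSo
    (by rw [← Set.sUnion_eq_iUnion, ← hGS]; exact hKG)
  refine ⟨Subtype.val '' (T : Set S), T.finite_toSet.image _, ?_, ?_, haK.trans_le ?_⟩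
  · rintro _ ⟨s, -, rfl⟩
    exact s.2.1
  · rintro y ⟨_, ⟨s, -, rfl⟩, hy⟩
    exact s.2.2 hy
  · refine measure_mono fun y hy => ?_
    obtain ⟨s, hs, hys⟩ := Set.mem_iUnion₂.1 (hKT hy)
    exact ⟨s, ⟨s, hs, rfl⟩, hys⟩

theorem weakSubbasis_generates :
    (inferInstance : TopologicalSpace (ProbabilityMeasure ℝ)) =
      TopologicalSpace.generateFrom weakSubbasis := by
  have hopen : ∀ F : Set (Set ℝ), F ⊆ TopologicalSpace.countableBasis ℝ → IsOpen (⋃₀ F) :=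
    fun F hF => isOpen_sUnion fun s hs => TopologicalSpace.isOpen_of_mem_countableBasis (hF hs)
  apply le_antisymm
  · apply le_generateFrom
    rintro _ ⟨⟨F, q⟩, ⟨⟨_, hF⟩, _⟩, rfl⟩
    exact isOpen_setOf_lt_probabilityMeasure (hopen F hF) _
  · apply le_of_nhds_le_nhds
    intro ν
    have hcount : (@nhds _ (TopologicalSpace.generateFrom weakSubbasis) ν).IsCountablyGenerated := by
      let t := TopologicalSpace.generateFrom weakSubbasis
      have : @SecondCountableTopology _ t := ⟨⟨weakSubbasis, weakSubbasis_countable, rfl⟩⟩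
      infer_instance
    refine tendsto_of_forall_isOpen_le_liminf' (μs := id) fun G hG => ?_
    refine le_of_forall_lt fun a ha => ?_
    obtain ⟨F, hFf, hFb, hFG, haF⟩ := exists_finite_lt_measure_sUnion ν hG ha
    obtain ⟨q, hq, haq, hqF⟩ := ENNReal.lt_iff_exists_rat_btwn.1 haF
    refine lt_of_lt_of_le haq (le_liminf_of_le (by isBoundedDefault) ?_)
    have hmemS : {η : ProbabilityMeasure ℝ | (Real.toNNReal q : ℝ≥0∞) < (η : Measure ℝ) (⋃₀ F)} ∈
        weakSubbasis := ⟨(F, q), ⟨⟨hFf, hFb⟩, trivial⟩, rfl⟩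
    have hmem : {η : ProbabilityMeasure ℝ | (Real.toNNReal q : ℝ≥0∞) < (η : Measure ℝ) (⋃₀ F)} ∈
        @nhds _ (TopologicalSpace.generateFrom weakSubbasis) ν :=
      (@IsOpen.mem_nhds_iff _ (TopologicalSpace.generateFrom weakSubbasis) ν _
        (TopologicalSpace.isOpen_generateFrom_of_mem hmemS)).2 hqF
    filter_upwards [hmem] with η hη
    exact (le_of_lt hη).trans (measure_mono hFG)

theorem measurable_coe_borel :
    @Measurable _ _ (borel (ProbabilityMeasure ℝ)) _
      (fun ν : ProbabilityMeasure ℝ => (ν : Measure ℝ)) := by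
  refine @Measurable.measure_of_isPiSystem_of_isProbabilityMeasure _ _
    (borel (ProbabilityMeasure ℝ)) _ _ _ {s : Set ℝ | IsOpen s}
    (BorelSpace.measurable_eq (α := ℝ)) isPiSystem_isOpen ?_
  intro s hs
  refine @measurable_of_Ioi _ _ _ _ _ (borel (ProbabilityMeasure ℝ)) _ _ _ _ ?_
  exact fun a => MeasurableSpace.measurableSet_generateFrom
    (isOpen_setOf_lt_probabilityMeasure hs a)

instance instBorelSpaceProbabilityMeasureReal : BorelSpace (ProbabilityMeasure ℝ) := by
  have h2 : SecondCountableTopology (ProbabilityMeasure ℝ) :=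
    ⟨⟨weakSubbasis, weakSubbasis_countable, weakSubbasis_generates⟩⟩
  constructor
  apply le_antisymm
  · exact measurable_iff_comap_le.1 measurable_coe_borel
  · rw [borel_eq_generateFrom_of_subbasis weakSubbasis_generates]
    refine MeasurableSpace.generateFrom_le ?_
    rintro _ ⟨⟨F, q⟩, ⟨⟨_, hF⟩, _⟩, rfl⟩
    have hm : MeasurableSet (⋃₀ F) :=
      (isOpen_sUnion fun s hs =>
        TopologicalSpace.isOpen_of_mem_countableBasis (hF hs)).measurableSet
    exact measurableSet_lt measurable_const
      ((Measure.measurable_coe hm).comp measurable_subtype_coe)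

/-! ### Dirichlet distributions and Dirichlet processes -/

noncomputable section

/-- The gamma distribution with shape `a` and rate `1`; for `a = 0` it is the point mass at `0`. -/
def gammaLaw (a : ℝ) : Measure ℝ :=
  if a = 0 then Measure.dirac 0 else gammaMeasure a 1

/-- The Dirichlet distribution with parameters `a i ≥ 0`, not all zero: the law of the vector
`(g i / ∑ j, g j)`, where the `g i` are independent and `g i` has the gamma distribution with
shape `a i`. If all `a i` are positive, it has the density proportional to `∏ i, x i ^ (a i - 1)`
on the simplex; a coordinate with `a i = 0` vanishes. -/
def dirichletDistribution {n : ℕ} (a : Fin n → ℝ) : Measure (Fin n → ℝ) :=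
  (Measure.pi fun i => gammaLaw (a i)).map fun g i => g i / ∑ j, g j

/-- `P` is a Dirichlet process with base distribution `ρ` and scaling parameter `c`: a random
probability measure such that, for every finite measurable partition `A` of the line, the vector
`(P (A i))` has the Dirichlet distribution with parameters `c * ρ (A i)`. -/
structure IsDirichletProcess {Ω : Type*} [MeasurableSpace Ω] (P : Ω → ProbabilityMeasure ℝ)
    (ρ : ProbabilityMeasure ℝ) (c : ℝ) (Q : Measure Ω) : Prop where
  aemeasurable : AEMeasurable P Q
  hasLaw_partition : ∀ (n : ℕ) (A : Fin n → Set ℝ), (∀ i, MeasurableSet (A i)) →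
    Pairwise (Function.onFun Disjoint A) → ⋃ i, A i = Set.univ →
    HasLaw (fun ω i => (P ω : Measure ℝ).real (A i))
      (dirichletDistribution fun i => c * (ρ : Measure ℝ).real (A i)) Q

/-! ### Empirical measures and spectral measures -/

/-- The empirical measure `(n + 1)⁻¹ ∑ i, δ_{x i}` of `n + 1` points. -/
def empiricalMeasure {n : ℕ} (x : Fin (n + 1) → ℝ) : ProbabilityMeasure ℝ :=
  ⟨((n + 1 : ℕ) : ℝ≥0∞)⁻¹ • ∑ i, Measure.dirac (x i), ⟨by
    simp [ENNReal.inv_mul_cancel]⟩⟩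

theorem isProbabilityMeasure_sum_smul_dirac {n : ℕ} {w : Fin n → ℝ}
    (hw : w ∈ stdSimplex ℝ (Fin n)) (x : Fin n → ℝ) :
    IsProbabilityMeasure (∑ i, ENNReal.ofReal (w i) • Measure.dirac (x i)) := by
  refine ⟨?_⟩
  simp [← ENNReal.ofReal_sum_of_nonneg fun i _ => hw.1 i, hw.2]

open Classical in
/-- The probability measure `∑ i, w i • δ_{x i}`, for weights `w` in the standard simplex. A random
vector with a Dirichlet distribution is in the simplex almost surely; elsewhere the value is an
arbitrary fixed probability measure. -/
def spectralMeasure {n : ℕ} (w x : Fin n → ℝ) : ProbabilityMeasure ℝ :=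
  if hw : w ∈ stdSimplex ℝ (Fin n) then
    ⟨∑ i, ENNReal.ofReal (w i) • Measure.dirac (x i), isProbabilityMeasure_sum_smul_dirac hw x⟩
  else diracProba 0

/-- Weak convergence, in probability, of random probability measures `ξ N` (which may live on
different probability spaces) to a deterministic probability measure `ρ`: for every bounded
continuous `f`, the integrals `∫ f dξ_N` converge in probability to `∫ f dρ`. -/
def TendstoWeaklyInProbability {Ω : ℕ → Type*} [∀ N, MeasurableSpace (Ω N)]
    (ξ : ∀ N, Ω N → ProbabilityMeasure ℝ) (ρ : ProbabilityMeasure ℝ)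
    (Q : ∀ N, Measure (Ω N)) : Prop :=
  ∀ f : BoundedContinuousFunction ℝ ℝ, ∀ ε : ℝ, 0 < ε →
    Tendsto (fun N => Q N {ω | ε ≤ |∫ x, f x ∂(ξ N ω : Measure ℝ) - ∫ x, f x ∂(ρ : Measure ℝ)|})
      atTop (𝓝 0)

end

/-! The proof rests on the gamma transform `f ↦ E[φ(∫ f dP)]` of a random probability measure `P`,
where `φ` is the characteristic function of the gamma law of shape `c`. By `charFun_gammaLaw`,
`φ(y) = exp (-c log (1 - i y))`.

A Dirichlet vector of total parameter `c`, multiplied by an independent gamma variable of shape `c`,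
becomes a vector of independent gamma variables
(`map_smul_gammaLaw_prod_dirichletDistribution`). So the transform of a Dirichlet process is
`exp (-c ∫ log (1 - i f) dρ)` (`IsDirichletProcess.integral_charFun`), and for the spectral measures,
where the weights are integrated out first, it is `E[exp (-c ∫ log (1 - i f) dL_N)]`
(`integral_charFun_spectralMeasure`). The function `log (1 - i f)` is bounded and continuous, so the
second expression converges to the first one (`tendsto_integral_exp_logSymbol`).

Convergence of the transforms implies weak convergence of the laws
(`tendsto_of_tendsto_integral_charFun`). For finitely many test functions, the vector of the integrals
against `s • P`, with an independent gamma variable `s`, has a characteristic function given by the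
transform, so Lévy's theorem applies; the total mass `s` is positive and can be divided out. The
sets described by finitely many integrals generate the topology of the space of probability
measures, which is second countable, and the portmanteau theorem finishes this part. The limit law is
given, so tightness is not needed.

The Dirichlet process exists by stick breaking (`exists_isDirichletProcess`). The Dirichlet vector
`d` of the cells of a partition satisfies `d ∼ v e + (1 - v) d`, where `v` is a beta variable and
`e` is the vertex of the cell of an independent point with law `ρ`
(`lintegral_dirichlet_fixed_point`); this comes from the size bias of gamma laws. Iterating the
equation fills up the remainder of the stick, which tends to `0`, with a Dirichlet vector, so the
masses of the cells under the stick-breaking measure have the Dirichlet law.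

The scaling property `lintegral_gammaLaw_tilt` gives the independence of the sum and the normalized
vector of independent gamma variables, on which both parts depend. -/

/-! ### Gamma laws -/

theorem isProbabilityMeasure_gammaLaw {a : ℝ} (ha : 0 ≤ a) :
    IsProbabilityMeasure (gammaLaw a) := by
  unfold gammaLaw
  split_ifs with h
  · infer_instance
  · exact isProbabilityMeasure_gammaMeasure (lt_of_le_of_ne ha (Ne.symm h)) one_pos

theorem gammaLaw_zero : gammaLaw 0 = Measure.dirac 0 := if_pos rfl

theorem gammaLaw_of_pos {a : ℝ} (ha : 0 < a) :
    gammaLaw a = volume.withDensity (gammaPDF a 1) := if_neg ha.ne'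

theorem measurable_gammaPDF (a r : ℝ) : Measurable (gammaPDF a r) :=
  (measurable_gammaPDFReal a r).ennreal_ofReal

theorem ae_pos_gammaLaw {a : ℝ} (ha : 0 < a) : ∀ᵐ x ∂gammaLaw a, 0 < x := by
  rw [gammaLaw_of_pos ha, ae_withDensity_iff (measurable_gammaPDF a 1)]
  have h0 : ∀ᵐ x : ℝ, x ≠ 0 := by simp [ae_iff]
  filter_upwards [h0] with x hx0 hx
  by_contra hlt
  exact hx (gammaPDF_of_neg (lt_of_le_of_ne (not_lt.1 hlt) hx0))

theorem ae_nonneg_gammaLaw {a : ℝ} (ha : 0 ≤ a) : ∀ᵐ x ∂gammaLaw a, 0 ≤ x := by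
  rcases ha.eq_or_lt with rfl | ha
  · rw [gammaLaw_zero, ae_dirac_iff measurableSet_Ici]
  · exact (ae_pos_gammaLaw ha).mono fun x hx => hx.le

/-- Scaling: the gamma law with rate `r` is both the exponential tilt of the gamma law with rate `1`
and its image under division by `r`. -/
theorem lintegral_gammaLaw_tilt {a r : ℝ} (ha : 0 ≤ a) (hr : 0 < r) {F : ℝ → ℝ≥0∞}
    (hF : Measurable F) :
    ∫⁻ x, ENNReal.ofReal (r ^ a * Real.exp ((1 - r) * x)) * F (r * x) ∂gammaLaw a =
      ∫⁻ x, F x ∂gammaLaw a := by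
  rcases ha.eq_or_lt with rfl | ha
  · rw [gammaLaw_zero, lintegral_dirac' _ (by fun_prop), lintegral_dirac' _ hF]
    simp
  · rw [gammaLaw_of_pos ha,
      lintegral_withDensity_eq_lintegral_mul _ (measurable_gammaPDF a 1) (by fun_prop),
      lintegral_withDensity_eq_lintegral_mul _ (measurable_gammaPDF a 1) hF]
    have hvol := Real.smul_map_volume_mul_left hr.ne'
    conv_rhs => rw [← hvol]
    rw [lintegral_smul_measure,
      lintegral_map ((measurable_gammaPDF a 1).mul hF) (by fun_prop), smul_eq_mul,
      ← lintegral_const_mul _ (f := fun x => (gammaPDF a 1 * F) (r * x))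
        (((measurable_gammaPDF a 1).mul hF).comp (measurable_const_mul r))]
    refine lintegral_congr fun x => ?_
    simp only [Pi.mul_apply]
    rw [← mul_assoc, ← mul_assoc]
    congr 1
    rcases lt_or_ge x 0 with hx | hx
    · rw [gammaPDF_of_neg hx, gammaPDF_of_neg (mul_neg_of_pos_of_neg hr hx)]
      simp
    · rw [gammaPDF_of_nonneg hx, gammaPDF_of_nonneg (mul_nonneg hr.le hx),
        ← ENNReal.ofReal_mul' (by positivity), ← ENNReal.ofReal_mul' (by positivity)]
      congr 1
      rw [abs_of_pos hr, Real.mul_rpow hr.le hx, Real.rpow_sub_one hr.ne',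
        show (1 - r) * x = -(1 * (r * x)) + x by ring, Real.exp_add, Real.exp_neg (1 * x), one_mul x]
      field_simp

theorem lintegral_exp_gammaLaw {a t : ℝ} (ha : 0 ≤ a) (ht : t < 1) :
    ∫⁻ x, ENNReal.ofReal (Real.exp (t * x)) ∂gammaLaw a = ENNReal.ofReal ((1 - t) ^ (-a)) := by
  have := isProbabilityMeasure_gammaLaw ha
  have hr : 0 < 1 - t := by linarith
  have h := lintegral_gammaLaw_tilt ha hr (F := fun _ => 1) measurable_const
  simp only [mul_one, sub_sub_cancel, lintegral_const, measure_univ] at h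
  simp_rw [ENNReal.ofReal_mul (Real.rpow_nonneg hr.le a)] at h
  rw [lintegral_const_mul _ (by fun_prop)] at h
  rw [Real.rpow_neg hr.le, ENNReal.ofReal_inv_of_pos (Real.rpow_pos_of_pos hr a)]
  exact ENNReal.eq_inv_of_mul_eq_one_left (by rw [mul_comm]; exact h)

/-! ### Uniqueness from the moment generating function on a half-line -/

theorem eqOn_halfPlane_of_forall_ofReal {f g : ℂ → ℂ} (hf : AnalyticOnNhd ℂ f {z | z.re < 1})
    (hg : AnalyticOnNhd ℂ g {z | z.re < 1}) (h : ∀ t : ℝ, t < 1 → f t = g t) :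
    Set.EqOn f g {z | z.re < 1} := by
  refine AnalyticOnNhd.eqOn_of_preconnected_of_frequently_eq hf hg
    (convex_halfSpace_re_lt 1).isPreconnected (z₀ := 0) (by simp) ?_
  have h_real : ∃ᶠ x : ℝ in 𝓝[≠] 0, f x = g x := by
    refine Eventually.frequently ?_
    exact nhdsWithin_le_nhds ((eventually_lt_nhds one_pos).mono fun x hx => h x hx)
  have ht : Tendsto (fun x : ℝ => (x : ℂ)) (𝓝[≠] 0) (𝓝[≠] 0) := by
    refine tendsto_nhdsWithin_iff.2 ⟨?_, ?_⟩
    · exact (Complex.continuous_ofReal.tendsto' 0 0 (by simp)).mono_left nhdsWithin_le_nhds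
    · filter_upwards [self_mem_nhdsWithin] with x hx
      simpa using hx
  exact ht.frequently h_real

theorem analyticOnNhd_complexMGF_halfPlane {μ : Measure ℝ}
    (h : ∀ t < 1, ∫⁻ x, ENNReal.ofReal (Real.exp (t * x)) ∂μ ≠ ∞) :
    AnalyticOnNhd ℂ (complexMGF id μ) {z | z.re < 1} := by
  refine analyticOnNhd_complexMGF.mono fun z hz => ?_
  refine interior_maximal (s := integrableExpSet id μ) (t := Set.Iio (1 : ℝ)) (fun t ht => ?_)
    isOpen_Iio hz
  refine ⟨by fun_prop, ?_⟩
  rw [hasFiniteIntegral_iff_ofReal (ae_of_all _ fun x => (Real.exp_pos _).le)]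
  exact (h t ht).lt_top

theorem mgf_eq_toReal_lintegral {μ : Measure ℝ} (t : ℝ) :
    mgf id μ t = (∫⁻ x, ENNReal.ofReal (Real.exp (t * x)) ∂μ).toReal :=
  integral_eq_lintegral_of_nonneg_ae (ae_of_all _ fun x => (Real.exp_pos _).le) (by fun_prop)

/-- Two finite measures with the same finite moment generating function on `(-∞, 1)` are equal: by
analytic continuation to the half-plane `re z < 1`, they have the same characteristic function. -/
theorem measure_ext_of_lintegral_exp {μ ν : Measure ℝ} [IsFiniteMeasure μ] [IsFiniteMeasure ν]
    (hfin : ∀ t < 1, ∫⁻ x, ENNReal.ofReal (Real.exp (t * x)) ∂μ ≠ ∞)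
    (h : ∀ t < 1, ∫⁻ x, ENNReal.ofReal (Real.exp (t * x)) ∂μ =
      ∫⁻ x, ENNReal.ofReal (Real.exp (t * x)) ∂ν) : μ = ν := by
  have heq := eqOn_halfPlane_of_forall_ofReal (analyticOnNhd_complexMGF_halfPlane hfin)
    (analyticOnNhd_complexMGF_halfPlane fun t ht => h t ht ▸ hfin t ht) fun t ht => by
      rw [complexMGF_ofReal, complexMGF_ofReal, mgf_eq_toReal_lintegral, mgf_eq_toReal_lintegral,
        h t ht]
  refine Measure.ext_of_charFun (funext fun t => ?_)
  rw [← complexMGF_id_mul_I, ← complexMGF_id_mul_I]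
  exact heq (by simp)

/-- The characteristic function of the gamma law, by analytic continuation of its moment generating
function. -/
theorem charFun_gammaLaw {a : ℝ} (ha : 0 ≤ a) (t : ℝ) :
    charFun (gammaLaw a) t = Complex.exp (-a * Complex.log (1 - t * Complex.I)) := by
  have hg : AnalyticOnNhd ℂ (fun z => Complex.exp (-a * Complex.log (1 - z))) {z | z.re < 1} := by
    intro z hz
    refine AnalyticAt.cexp (analyticAt_const.mul ((analyticAt_const.sub analyticAt_id).clog ?_))
    left
    have : z.re < 1 := hz
    simpa using this
  have heq := eqOn_halfPlane_of_forall_ofReal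
    (analyticOnNhd_complexMGF_halfPlane (μ := gammaLaw a) fun t ht => by
      rw [lintegral_exp_gammaLaw ha ht]; exact ENNReal.ofReal_ne_top) hg fun t ht => by
    have hr : 0 < 1 - t := by linarith
    rw [complexMGF_ofReal, mgf_eq_toReal_lintegral, lintegral_exp_gammaLaw ha ht,
      ENNReal.toReal_ofReal (Real.rpow_nonneg hr.le _), Real.rpow_def_of_pos hr]
    push_cast [Complex.ofReal_log hr.le]
    rw [mul_comm]
  rw [← complexMGF_id_mul_I]
  exact heq (by simp)

/-! ### Products of gamma laws and Dirichlet distributions -/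

/-- The scaling property of products of gamma laws; the tilt depends on the sum only. -/
theorem lintegral_pi_gammaLaw_tilt {ι : Type*} [Fintype ι] {a : ι → ℝ} (ha : ∀ i, 0 ≤ a i)
    {r : ℝ} (hr : 0 < r) {F : (ι → ℝ) → ℝ≥0∞} (hF : Measurable F) :
    ∫⁻ g, ENNReal.ofReal (r ^ (∑ i, a i) * Real.exp ((1 - r) * ∑ i, g i)) * F (r • g)
        ∂Measure.pi (fun i => gammaLaw (a i)) =
      ∫⁻ g, F g ∂Measure.pi fun i => gammaLaw (a i) := by
  have := fun i => isProbabilityMeasure_gammaLaw (ha i)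
  set ψ : (ι → ℝ) → ℝ≥0∞ :=
    fun g => ENNReal.ofReal (r ^ (∑ i, a i) * Real.exp ((1 - r) * ∑ i, g i)) with hψ
  have hψm : Measurable ψ := by fun_prop
  have hψ' : ∀ g, ψ g = ∏ i, ENNReal.ofReal (r ^ a i * Real.exp ((1 - r) * g i)) := by
    intro g
    rw [← ENNReal.ofReal_prod_of_nonneg fun i _ => by positivity, Finset.prod_mul_distrib,
      ← Real.rpow_sum_of_pos hr, ← Real.exp_sum, ← Finset.mul_sum]
  have key : Measure.pi (fun i => gammaLaw (a i)) =
      ((Measure.pi fun i => gammaLaw (a i)).withDensity ψ).map (r • ·) := by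
    refine Measure.pi_eq fun s hs => ?_
    have hms : MeasurableSet (Set.univ.pi s) := MeasurableSet.univ_pi hs
    have hsm : Measurable fun g : ι → ℝ => r • g := measurable_const_smul r
    rw [Measure.map_apply hsm hms, withDensity_apply _ (hsm hms),
      ← lintegral_indicator (hsm hms)]
    have hX : ∀ i, Measurable fun x : ℝ =>
        ENNReal.ofReal (r ^ a i * Real.exp ((1 - r) * x)) * (s i).indicator 1 (r * x) := by
      intro i
      have h1 : Measurable ((s i).indicator (1 : ℝ → ℝ≥0∞)) := measurable_one.indicator (hs i)
      exact Measurable.mul (by fun_prop) (h1.comp (measurable_const_mul r))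
    calc
      _ = ∫⁻ g, ∏ i, ENNReal.ofReal (r ^ a i * Real.exp ((1 - r) * g i)) *
            (s i).indicator 1 (r * g i) ∂Measure.pi (fun i => gammaLaw (a i)) := by
        refine lintegral_congr fun g => ?_
        rw [Finset.prod_mul_distrib, ← hψ' g]
        by_cases hg : ∀ i, r * g i ∈ s i
        · rw [Set.indicator_of_mem (by simpa [Set.mem_pi] using hg)]
          simp [Set.indicator_of_mem (hg _)]
        · rw [Set.indicator_of_notMem (by simpa [Set.mem_pi] using hg)]
          push Not at hg
          obtain ⟨i, hi⟩ := hg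
          rw [Finset.prod_eq_zero (Finset.mem_univ i) (Set.indicator_of_notMem hi _), mul_zero]
      _ = ∏ i, ∫⁻ g, ENNReal.ofReal (r ^ a i * Real.exp ((1 - r) * g i)) *
            (s i).indicator 1 (r * g i) ∂Measure.pi (fun i => gammaLaw (a i)) :=
        lintegral_prod_eq_prod_lintegral_of_indepFun Finset.univ _
          (iIndepFun_pi fun i => (hX i).aemeasurable) fun i => (hX i).comp (measurable_pi_apply i)
      _ = ∏ i, gammaLaw (a i) (s i) := by
        refine Finset.prod_congr rfl fun i _ => ?_
        rw [← lintegral_indicator_one (hs i),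
          ← lintegral_gammaLaw_tilt (ha i) hr (measurable_one.indicator (hs i)),
          ← (measurePreserving_eval (fun i => gammaLaw (a i)) i).lintegral_comp (hX i)]
  conv_rhs => rw [key]
  rw [lintegral_map hF (measurable_const_smul r), lintegral_withDensity_eq_lintegral_mul _ hψm
    (g := fun g => F (r • g)) (hF.comp (measurable_const_smul r))]
  rfl

theorem measurable_normalize {n : ℕ} :
    Measurable fun (g : Fin n → ℝ) i => g i / ∑ j, g j := by
  fun_prop

theorem isProbabilityMeasure_dirichletDistribution {n : ℕ} {a : Fin n → ℝ} (ha : ∀ i, 0 ≤ a i) :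
    IsProbabilityMeasure (dirichletDistribution a) := by
  have := fun i => isProbabilityMeasure_gammaLaw (ha i)
  exact Measure.isProbabilityMeasure_map measurable_normalize.aemeasurable

/-- The sum of independent gamma variables has a gamma law and is independent of the normalized
vector. The Laplace transform of the sum on the event that the normalized vector lies in a given set
follows from scaling, because the normalized vector is scale invariant. -/
theorem map_sum_normalize_pi_gammaLaw {n : ℕ} {a : Fin n → ℝ} (ha : ∀ i, 0 ≤ a i) :
    (Measure.pi fun i => gammaLaw (a i)).map (fun g => (∑ i, g i, fun i => g i / ∑ j, g j)) =
      (gammaLaw (∑ i, a i)).prod (dirichletDistribution a) := by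
  have := fun i => isProbabilityMeasure_gammaLaw (ha i)
  have := isProbabilityMeasure_dirichletDistribution ha
  have hc : 0 ≤ ∑ i, a i := Finset.sum_nonneg fun i _ => ha i
  have := isProbabilityMeasure_gammaLaw hc
  have hSm : Measurable fun g : Fin n → ℝ => ∑ i, g i := by fun_prop
  refine (Measure.prod_eq fun s t hs ht => ?_).symm
  set B := (fun (g : Fin n → ℝ) i => g i / ∑ j, g j) ⁻¹' t with hB
  have hBm : MeasurableSet B := measurable_normalize ht
  have hDt : dirichletDistribution a t = Measure.pi (fun i => gammaLaw (a i)) B :=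
    Measure.map_apply measurable_normalize ht
  have hexp : ∀ τ < 1, ∫⁻ x, ENNReal.ofReal (Real.exp (τ * x))
      ∂(((Measure.pi fun i => gammaLaw (a i)).restrict B).map fun g => ∑ i, g i) =
      dirichletDistribution a t * ENNReal.ofReal ((1 - τ) ^ (-∑ i, a i)) := by
    intro τ hτ
    have hr : 0 < 1 - τ := by linarith
    have h := lintegral_pi_gammaLaw_tilt ha hr (measurable_one.indicator hBm)
    -- Dilations do not change the normalized vector, so `B` is a cone.
    have hinv : ∀ g : Fin n → ℝ, (1 - τ) • g ∈ B ↔ g ∈ B := by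
      intro g
      simp only [hB, Set.mem_preimage, Pi.smul_apply, smul_eq_mul, ← Finset.mul_sum,
        mul_div_mul_left _ _ hr.ne']
    have hinv' : ∀ g : Fin n → ℝ, B.indicator (1 : (Fin n → ℝ) → ℝ≥0∞) ((1 - τ) • g) =
        B.indicator 1 g := fun g => by
      by_cases hg : g ∈ B
      · rw [Set.indicator_of_mem hg, Set.indicator_of_mem ((hinv g).2 hg)]; rfl
      · rw [Set.indicator_of_notMem hg, Set.indicator_of_notMem (mt (hinv g).1 hg)]
    simp_rw [hinv', sub_sub_cancel, ENNReal.ofReal_mul (Real.rpow_nonneg hr.le _), mul_assoc] at h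
    have hm : Measurable fun g : Fin n → ℝ => ENNReal.ofReal (Real.exp (τ * ∑ i, g i)) *
        B.indicator (1 : (Fin n → ℝ) → ℝ≥0∞) g :=
      Measurable.mul (by fun_prop) (measurable_one.indicator hBm)
    rw [lintegral_const_mul _ hm, lintegral_indicator_one hBm, ← hDt] at h
    rw [lintegral_map (by fun_prop) hSm, ← lintegral_indicator hBm, Real.rpow_neg hr.le,
      ENNReal.ofReal_inv_of_pos (Real.rpow_pos_of_pos hr _), ← h, mul_comm, ← mul_assoc,
      ENNReal.inv_mul_cancel (by simp [Real.rpow_pos_of_pos hr]) ENNReal.ofReal_ne_top, one_mul]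
    refine lintegral_congr fun g => ?_
    by_cases hg : g ∈ B <;> simp [hg]
  have key : ((Measure.pi fun i => gammaLaw (a i)).restrict B).map (fun g => ∑ i, g i) =
      dirichletDistribution a t • gammaLaw (∑ i, a i) := by
    have hfm : IsFiniteMeasure (dirichletDistribution a t • gammaLaw (∑ i, a i)) :=
      Measure.smul_finite _ (measure_ne_top _ _)
    refine measure_ext_of_lintegral_exp (fun τ hτ => ?_) fun τ hτ => ?_
    · rw [hexp τ hτ]
      exact ENNReal.mul_ne_top (measure_ne_top _ _) ENNReal.ofReal_ne_top
    · rw [hexp τ hτ, lintegral_smul_measure, lintegral_exp_gammaLaw hc hτ, smul_eq_mul]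
  rw [Measure.map_apply (hSm.prodMk measurable_normalize) (hs.prod ht)]
  have := congrArg (fun μ => μ s) key
  simp only [Measure.smul_apply, smul_eq_mul] at this
  rw [Measure.map_apply hSm hs, Measure.restrict_apply (hSm hs)] at this
  rw [mul_comm, ← this]
  rfl

theorem ae_sum_pos_pi_gammaLaw {ι : Type*} [Fintype ι] {a : ι → ℝ} (ha : ∀ i, 0 ≤ a i)
    (hc : 0 < ∑ i, a i) :
    ∀ᵐ g ∂Measure.pi fun i => gammaLaw (a i), (∀ i, 0 ≤ g i) ∧ 0 < ∑ i, g i := by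
  have := fun i => isProbabilityMeasure_gammaLaw (ha i)
  have h0 : ∀ᵐ g ∂Measure.pi fun i => gammaLaw (a i), ∀ i, 0 ≤ g i :=
    ae_all_iff.2 fun i => Measure.tendsto_eval_ae_ae.eventually (ae_nonneg_gammaLaw (ha i))
  obtain ⟨j, -, hj⟩ := Finset.exists_lt_of_sum_lt (s := Finset.univ) (f := fun _ => (0 : ℝ))
    (g := a) (by simpa using hc)
  filter_upwards [h0, (Measure.tendsto_eval_ae_ae (i := j)).eventually (ae_pos_gammaLaw hj)]
    with g hg hgj
  exact ⟨hg, Finset.sum_pos' (fun i _ => hg i) ⟨j, Finset.mem_univ j, hgj⟩⟩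

theorem ae_mem_stdSimplex_dirichletDistribution {n : ℕ} {a : Fin n → ℝ} (ha : ∀ i, 0 ≤ a i)
    (hc : 0 < ∑ i, a i) : ∀ᵐ d ∂dirichletDistribution a, d ∈ stdSimplex ℝ (Fin n) := by
  have hms : MeasurableSet {d : Fin n → ℝ | d ∈ stdSimplex ℝ (Fin n)} :=
    (isClosed_stdSimplex ℝ (Fin n)).measurableSet
  rw [dirichletDistribution, ae_map_iff measurable_normalize.aemeasurable hms]
  filter_upwards [ae_sum_pos_pi_gammaLaw ha hc] with g hg
  refine ⟨fun i => div_nonneg (hg.1 i) hg.2.le, ?_⟩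
  rw [← Finset.sum_div, div_self hg.2.ne']

/-- Multiplying a Dirichlet vector by an independent gamma variable gives independent gamma
variables. -/
theorem map_smul_gammaLaw_prod_dirichletDistribution {n : ℕ} {a : Fin n → ℝ} (ha : ∀ i, 0 ≤ a i)
    (hc : 0 < ∑ i, a i) :
    ((gammaLaw (∑ i, a i)).prod (dirichletDistribution a)).map (fun p => p.1 • p.2) =
      Measure.pi fun i => gammaLaw (a i) := by
  rw [← map_sum_normalize_pi_gammaLaw ha, Measure.map_map (by fun_prop) (by fun_prop)]
  conv_rhs => rw [← Measure.map_id (μ := Measure.pi fun i => gammaLaw (a i))]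
  refine Measure.map_congr ?_
  filter_upwards [ae_sum_pos_pi_gammaLaw ha hc] with g hg
  ext i
  simp [mul_div_cancel₀ _ hg.2.ne']

/-! ### Resampling one coordinate of a product measure -/

/-- Replacing one coordinate by an independent copy does not change a product measure. -/
theorem map_update_infinitePi {ι : Type*} [DecidableEq ι] {X : ι → Type*}
    [∀ i, MeasurableSpace (X i)] (μ : ∀ i, Measure (X i)) [∀ i, IsProbabilityMeasure (μ i)]
    (j : ι) :
    ((μ j).prod (Measure.infinitePi μ)).map (fun p => Function.update p.2 j p.1) =
      Measure.infinitePi μ := by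
  have hm : Measurable fun p : X j × (∀ i, X i) => Function.update p.2 j p.1 :=
    measurable_update'.comp measurable_swap
  refine Measure.eq_infinitePi μ fun s t ht => ?_
  rw [Measure.map_apply hm (MeasurableSet.pi s.countable_toSet fun i _ => ht i)]
  by_cases hj : j ∈ s
  · have : (fun p : X j × (∀ i, X i) => Function.update p.2 j p.1) ⁻¹' (Set.pi s t) =
        t j ×ˢ Set.pi (s.erase j : Finset ι) t := by
      ext p
      simp only [Set.mem_preimage, Set.mem_pi, Set.mem_prod, Finset.coe_erase, Set.mem_sdiff,
        Set.mem_singleton_iff, Finset.mem_coe]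
      constructor
      · intro h
        refine ⟨by simpa using h j hj, fun i hi => ?_⟩
        simpa [Function.update_of_ne hi.2] using h i hi.1
      · rintro ⟨h1, h2⟩ i hi
        rcases eq_or_ne i j with rfl | hij
        · simpa using h1
        · simpa [Function.update_of_ne hij] using h2 i ⟨hi, hij⟩
    rw [this, Measure.prod_prod, Measure.infinitePi_pi μ (fun i _ => ht i),
      Finset.mul_prod_erase _ (fun i => μ i (t i)) hj]
  · have : (fun p : X j × (∀ i, X i) => Function.update p.2 j p.1) ⁻¹' (Set.pi s t) =
        Set.univ ×ˢ Set.pi s t := by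
      ext p
      simp only [Set.mem_preimage, Set.mem_pi, Set.mem_prod, Set.mem_univ, true_and]
      refine forall₂_congr fun i hi => ?_
      rw [Function.update_of_ne (by rintro rfl; exact hj hi)]
    rw [this, Measure.prod_prod, Measure.infinitePi_pi μ (fun i _ => ht i), measure_univ, one_mul]

theorem lintegral_infinitePi_update {ι : Type*} [DecidableEq ι] {X : ι → Type*}
    [∀ i, MeasurableSpace (X i)] (μ : ∀ i, Measure (X i)) [∀ i, IsProbabilityMeasure (μ i)]
    (j : ι) {G : (∀ i, X i) → ℝ≥0∞} (hG : Measurable G) :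
    ∫⁻ ω, G ω ∂Measure.infinitePi μ =
      ∫⁻ ω, ∫⁻ y, G (Function.update ω j y) ∂μ j ∂Measure.infinitePi μ := by
  have hm : Measurable fun p : X j × (∀ i, X i) => Function.update p.2 j p.1 :=
    measurable_update'.comp measurable_swap
  conv_lhs => rw [← map_update_infinitePi μ j]
  rw [lintegral_map hG hm, lintegral_prod_symm (fun p => G (Function.update p.2 j p.1)) (hG.comp hm).aemeasurable]

/-! ### Size-biased gamma laws -/

theorem map_add_gammaLaw_prod {a b : ℝ} (ha : 0 ≤ a) (hb : 0 ≤ b) :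
    ((gammaLaw a).prod (gammaLaw b)).map (fun p => p.1 + p.2) = gammaLaw (a + b) := by
  have := isProbabilityMeasure_gammaLaw ha
  have := isProbabilityMeasure_gammaLaw hb
  have := isProbabilityMeasure_gammaLaw (add_nonneg ha hb)
  have h : ∀ t < 1, ∫⁻ x, ENNReal.ofReal (Real.exp (t * x))
      ∂(((gammaLaw a).prod (gammaLaw b)).map fun p => p.1 + p.2) =
      ∫⁻ x, ENNReal.ofReal (Real.exp (t * x)) ∂gammaLaw (a + b) := by
    intro t ht
    have hr : 0 < 1 - t := by linarith
    rw [lintegral_map (by fun_prop) (by fun_prop), lintegral_prod _ (by fun_prop)]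
    simp_rw [mul_add, Real.exp_add, ENNReal.ofReal_mul (Real.exp_pos _).le]
    rw [lintegral_lintegral_mul (by fun_prop) (by fun_prop), lintegral_exp_gammaLaw ha ht,
      lintegral_exp_gammaLaw hb ht, lintegral_exp_gammaLaw (add_nonneg ha hb) ht,
      ← ENNReal.ofReal_mul (Real.rpow_nonneg hr.le _), ← Real.rpow_add hr, neg_add]
  refine measure_ext_of_lintegral_exp (fun t ht => ?_) h
  rw [h t ht, lintegral_exp_gammaLaw (add_nonneg ha hb) ht]
  exact ENNReal.ofReal_ne_top

/-- Size bias: adding an independent exponential variable to a gamma variable reweights its law by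
the identity function. -/
theorem lintegral_gammaLaw_size_bias {a : ℝ} (ha : 0 ≤ a) {φ : ℝ → ℝ≥0∞} (hφ : Measurable φ) :
    ENNReal.ofReal a * ∫⁻ h, ∫⁻ x, φ (x + h) ∂gammaLaw a ∂gammaLaw 1 =
      ∫⁻ x, ENNReal.ofReal x * φ x ∂gammaLaw a := by
  have := isProbabilityMeasure_gammaLaw ha
  have := isProbabilityMeasure_gammaLaw zero_le_one
  rcases ha.eq_or_lt with rfl | hpos
  · rw [gammaLaw_zero, lintegral_dirac' _ (by fun_prop)]
    simp
  · have h1 : ∫⁻ h, ∫⁻ x, φ (x + h) ∂gammaLaw a ∂gammaLaw 1 = ∫⁻ x, φ x ∂gammaLaw (a + 1) := by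
      rw [← map_add_gammaLaw_prod ha zero_le_one, lintegral_map hφ (by fun_prop),
        lintegral_prod_symm _ (by fun_prop)]
    rw [h1, gammaLaw_of_pos hpos, gammaLaw_of_pos (by linarith : 0 < a + 1),
      lintegral_withDensity_eq_lintegral_mul _ (measurable_gammaPDF _ _) hφ,
      lintegral_withDensity_eq_lintegral_mul _ (measurable_gammaPDF _ _) (by fun_prop),
      ← lintegral_const_mul _ ((measurable_gammaPDF _ _).mul hφ)]
    have h0 : ∀ᵐ x : ℝ, x ≠ 0 := by simp [ae_iff]
    refine lintegral_congr_ae (h0.mono fun x hx0 => ?_)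
    simp only [Pi.mul_apply]
    rw [← mul_assoc, ← mul_assoc]
    congr 1
    rcases lt_or_gt_of_ne hx0 with hx | hx
    · simp [gammaPDF_of_neg hx]
    · have hΓ := Real.Gamma_pos_of_pos hpos
      rw [gammaPDF_of_nonneg hx.le, gammaPDF_of_nonneg hx.le, ← ENNReal.ofReal_mul ha,
        ← ENNReal.ofReal_mul' hx.le]
      congr 1
      rw [Real.Gamma_add_one hpos.ne', add_sub_cancel_right, Real.rpow_sub_one hx.ne']
      simp only [Real.one_rpow]
      field_simp

theorem lintegral_id_gammaLaw {a : ℝ} (ha : 0 ≤ a) :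
    ∫⁻ x, ENNReal.ofReal x ∂gammaLaw a = ENNReal.ofReal a := by
  have := isProbabilityMeasure_gammaLaw ha
  have := isProbabilityMeasure_gammaLaw zero_le_one
  simpa using (lintegral_gammaLaw_size_bias ha (φ := fun _ => 1) measurable_const).symm

/-- Adding an independent exponential variable to one coordinate of a vector of independent gamma
variables reweights its law by that coordinate. -/
theorem lintegral_pi_gammaLaw_size_bias {ι : Type*} [Fintype ι] [DecidableEq ι] {a : ι → ℝ}
    (ha : ∀ i, 0 ≤ a i) (j : ι) {F : (ι → ℝ) → ℝ≥0∞} (hF : Measurable F) :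
    ENNReal.ofReal (a j) * ∫⁻ h, ∫⁻ g, F (Function.update g j (g j + h))
        ∂Measure.pi (fun i => gammaLaw (a i)) ∂gammaLaw 1 =
      ∫⁻ g, ENNReal.ofReal (g j) * F g ∂Measure.pi (fun i => gammaLaw (a i)) := by
  have := fun i => isProbabilityMeasure_gammaLaw (ha i)
  have := isProbabilityMeasure_gammaLaw zero_le_one
  have hu : Measurable fun p : (ι → ℝ) × ℝ => Function.update p.1 j p.2 := measurable_update'
  have hm1 : Measurable fun p : ℝ × (ι → ℝ) => F (Function.update p.2 j (p.2 j + p.1)) :=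
    hF.comp (hu.comp (Measurable.prodMk measurable_snd (by fun_prop)))
  rw [lintegral_lintegral_swap hm1.aemeasurable, ← Measure.infinitePi_eq_pi,
    lintegral_infinitePi_update (fun i => gammaLaw (a i)) j
      (G := fun g => ∫⁻ h, F (Function.update g j (g j + h)) ∂gammaLaw 1)
      (Measurable.lintegral_prod_right' (hm1.comp measurable_swap)),
    lintegral_infinitePi_update (fun i => gammaLaw (a i)) j
      (G := fun g => ENNReal.ofReal (g j) * F g) (by fun_prop)]
  simp only [Function.update_self, Function.update_idem]
  rw [← lintegral_const_mul]
  · refine lintegral_congr fun g => ?_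
    have hφ : Measurable fun x => F (Function.update g j x) := hF.comp (measurable_update g)
    rw [← lintegral_gammaLaw_size_bias (ha j) hφ, lintegral_lintegral_swap]
    exact (hφ.comp (by fun_prop : Measurable fun p : ℝ × ℝ => p.1 + p.2)).aemeasurable
  · refine Measurable.lintegral_prod_right' (f := fun p : (ι → ℝ) × ℝ =>
      ∫⁻ h, F (Function.update p.1 j (p.2 + h)) ∂gammaLaw 1) ?_
    refine Measurable.lintegral_prod_right' (f := fun p : ((ι → ℝ) × ℝ) × ℝ =>
      F (Function.update p.1.1 j (p.1.2 + p.2))) ?_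
    exact hF.comp (hu.comp (Measurable.prodMk (by fun_prop) (by fun_prop)))

/-! ### The distributional fixed point equation of the Dirichlet distribution -/

/-- The law of `h / (h + s)` for independent `h` and `s` with gamma laws of shapes `1` and `c`, that
is, the beta law with parameters `1` and `c`. -/
noncomputable def stickLaw (c : ℝ) : Measure ℝ :=
  ((gammaLaw 1).prod (gammaLaw c)).map fun p => p.1 / (p.1 + p.2)

theorem isProbabilityMeasure_stickLaw {c : ℝ} (hc : 0 ≤ c) :
    IsProbabilityMeasure (stickLaw c) := by
  have := isProbabilityMeasure_gammaLaw hc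
  have := isProbabilityMeasure_gammaLaw zero_le_one
  exact Measure.isProbabilityMeasure_map (by fun_prop)

theorem ae_mem_Ioo_stickLaw {c : ℝ} (hc : 0 < c) : ∀ᵐ v ∂stickLaw c, v ∈ Set.Ioo (0 : ℝ) 1 := by
  have := isProbabilityMeasure_gammaLaw hc.le
  have := isProbabilityMeasure_gammaLaw zero_le_one
  have hms : MeasurableSet {v : ℝ | v ∈ Set.Ioo (0 : ℝ) 1} := measurableSet_Ioo
  rw [stickLaw, ae_map_iff (by fun_prop) hms]
  filter_upwards [Measure.quasiMeasurePreserving_fst.ae (ae_pos_gammaLaw one_pos),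
    Measure.quasiMeasurePreserving_snd.ae (ae_pos_gammaLaw hc)] with p h1 h2
  have : 0 < p.1 + p.2 := add_pos h1 h2
  exact ⟨div_pos h1 this, (div_lt_one this).2 (by linarith)⟩

theorem lintegral_normalize_pi_gammaLaw {n : ℕ} {a : Fin n → ℝ} (ha : ∀ i, 0 ≤ a i)
    {F : (Fin n → ℝ) → ℝ≥0∞} (hF : Measurable F) :
    ∫⁻ g, ENNReal.ofReal (∑ i, g i) * F (fun i => g i / ∑ j, g j)
        ∂Measure.pi (fun i => gammaLaw (a i)) =
      ENNReal.ofReal (∑ i, a i) * ∫⁻ d, F d ∂dirichletDistribution a := by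
  have := isProbabilityMeasure_dirichletDistribution ha
  have hc : 0 ≤ ∑ i, a i := Finset.sum_nonneg fun i _ => ha i
  have := isProbabilityMeasure_gammaLaw hc
  rw [← lintegral_id_gammaLaw hc, ← lintegral_prod_mul (by fun_prop) (by fun_prop),
    ← map_sum_normalize_pi_gammaLaw ha, lintegral_map (by fun_prop) (by fun_prop)]

/-- Moving a Dirichlet vector towards a vertex by a beta variable biases it by the corresponding
coordinate. -/
theorem lintegral_stickLaw_dirichlet_single {n : ℕ} {a : Fin n → ℝ} (ha : ∀ i, 0 ≤ a i)
    (hc : 0 < ∑ i, a i) (j : Fin n) {F : (Fin n → ℝ) → ℝ≥0∞} (hF : Measurable F) :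
    ENNReal.ofReal (a j) * ∫⁻ v, ∫⁻ d, F (v • Pi.single j 1 + (1 - v) • d)
        ∂dirichletDistribution a ∂stickLaw (∑ i, a i) =
      ∫⁻ g, ENNReal.ofReal (g j) * F (fun i => g i / ∑ j, g j)
        ∂Measure.pi (fun i => gammaLaw (a i)) := by
  have := isProbabilityMeasure_dirichletDistribution ha
  have := isProbabilityMeasure_gammaLaw hc.le
  have := isProbabilityMeasure_gammaLaw zero_le_one
  have := fun i => isProbabilityMeasure_gammaLaw (ha i)
  have hu : Measurable fun p : (Fin n → ℝ) × ℝ => Function.update p.1 j p.2 := measurable_update'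
  have hFN : Measurable fun g : Fin n → ℝ => F (fun i => g i / ∑ j, g j) :=
    hF.comp measurable_normalize
  rw [← lintegral_pi_gammaLaw_size_bias ha j hFN]
  congr 1
  have hm0 : Measurable fun p : ℝ × (Fin n → ℝ) =>
      F (p.1 • Pi.single j 1 + (1 - p.1) • p.2) :=
    hF.comp (by fun_prop)
  rw [stickLaw, lintegral_map hm0.lintegral_prod_right' (by fun_prop), lintegral_prod]
  swap
  · exact (hm0.lintegral_prod_right'.comp
      (g := fun v => ∫⁻ d, F (v • Pi.single j 1 + (1 - v) • d) ∂dirichletDistribution a)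
      (by fun_prop : Measurable fun p : ℝ × ℝ => p.1 / (p.1 + p.2))).aemeasurable
  refine lintegral_congr_ae ?_
  filter_upwards [ae_pos_gammaLaw one_pos] with h hh
  have hm1 : Measurable fun g : Fin n → ℝ => Function.update g j (g j + h) :=
    hu.comp (Measurable.prodMk measurable_id (by fun_prop))
  have hm2 := hFN.comp hm1
  rw [← map_smul_gammaLaw_prod_dirichletDistribution ha hc,
    lintegral_map (f := fun g => F (fun i => Function.update g j (g j + h) i /
      ∑ k, Function.update g j (g j + h) k)) hm2 (by fun_prop),
    lintegral_prod (fun p : ℝ × (Fin n → ℝ) => F (fun i =>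
      Function.update (p.1 • p.2) j ((p.1 • p.2) j + h) i /
        ∑ k, Function.update (p.1 • p.2) j ((p.1 • p.2) j + h) k))
      (hm2.comp (by fun_prop : Measurable fun p : ℝ × (Fin n → ℝ) => p.1 • p.2)).aemeasurable]
  refine lintegral_congr_ae ?_
  filter_upwards [ae_pos_gammaLaw hc] with s hs
  refine lintegral_congr_ae ?_
  filter_upwards [ae_mem_stdSimplex_dirichletDistribution ha hc] with d hd
  have hup : Function.update (s • d) j ((s • d) j + h) = s • d + h • Pi.single j 1 := by
    ext i
    rcases eq_or_ne i j with rfl | hij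
    · simp
    · simp [hij]
  have hsum : ∑ k, (s • d + h • (Pi.single j 1 : Fin n → ℝ)) k = s + h := by
    simp [Finset.sum_add_distrib, ← Finset.mul_sum, hd.2]
  have hne : h + s ≠ 0 := (add_pos hh hs).ne'
  rw [hup, hsum]
  congr 1
  ext i
  simp only [Pi.add_apply, Pi.smul_apply, smul_eq_mul]
  field_simp
  ring

/-- The vector of the indicators at `x` of the sets `A i`. -/
noncomputable def indicatorVector {n : ℕ} (A : Fin n → Set ℝ) (x : ℝ) (i : Fin n) : ℝ :=
  (A i).indicator 1 x

theorem measurable_indicatorVector {n : ℕ} {A : Fin n → Set ℝ} (hA : ∀ i, MeasurableSet (A i)) :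
    Measurable (indicatorVector A) :=
  measurable_pi_lambda _ fun i => measurable_one.indicator (hA i)

theorem indicatorVector_eq_single {n : ℕ} {A : Fin n → Set ℝ}
    (hd : Pairwise (Function.onFun Disjoint A)) {j : Fin n} {x : ℝ} (hx : x ∈ A j) :
    indicatorVector A x = Pi.single j 1 := by
  ext i
  rcases eq_or_ne i j with rfl | hij
  · simp [indicatorVector, hx]
  · have : x ∉ A i := fun hi => Set.disjoint_left.1 (hd hij) hi hx
    simp [indicatorVector, this, hij]

theorem sum_measureReal_partition {n : ℕ} {A : Fin n → Set ℝ} (hA : ∀ i, MeasurableSet (A i))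
    (hd : Pairwise (Function.onFun Disjoint A)) (hU : ⋃ i, A i = Set.univ) (ρ : Measure ℝ)
    [IsProbabilityMeasure ρ] : ∑ i, ρ.real (A i) = 1 := by
  rw [← measureReal_iUnion_fintype hd hA, hU, probReal_univ]

/-- The Dirichlet distribution of the cells of a partition is invariant under moving the vector, by
a beta variable, towards the vertex of the cell that contains an independent point with law `ρ`. -/
theorem lintegral_dirichlet_fixed_point {n : ℕ} {A : Fin n → Set ℝ}
    (hA : ∀ i, MeasurableSet (A i)) (hd : Pairwise (Function.onFun Disjoint A))
    (hU : ⋃ i, A i = Set.univ) (ρ : Measure ℝ) [IsProbabilityMeasure ρ] {c : ℝ} (hc : 0 < c)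
    {F : (Fin n → ℝ) → ℝ≥0∞} (hF : Measurable F) :
    ∫⁻ x, ∫⁻ v, ∫⁻ d, F (v • indicatorVector A x + (1 - v) • d)
        ∂dirichletDistribution (fun i => c * ρ.real (A i)) ∂stickLaw c ∂ρ =
      ∫⁻ d, F d ∂dirichletDistribution fun i => c * ρ.real (A i) := by
  set a : Fin n → ℝ := fun i => c * ρ.real (A i) with ha_def
  have ha : ∀ i, 0 ≤ a i := fun i => mul_nonneg hc.le measureReal_nonneg
  have hsum : ∑ i, a i = c := by
    rw [ha_def, ← Finset.mul_sum, sum_measureReal_partition hA hd hU, mul_one]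
  have hcs : 0 < ∑ i, a i := hsum ▸ hc
  set T : Fin n → ℝ≥0∞ := fun j => ∫⁻ v, ∫⁻ d, F (v • Pi.single j 1 + (1 - v) • d)
    ∂dirichletDistribution a ∂stickLaw c with hT
  have h1 : ∫⁻ x, ∫⁻ v, ∫⁻ d, F (v • indicatorVector A x + (1 - v) • d)
      ∂dirichletDistribution a ∂stickLaw c ∂ρ = ∑ j, ρ (A j) * T j := by
    rw [← setLIntegral_univ, ← hU, lintegral_iUnion hA hd, tsum_fintype]
    refine Finset.sum_congr rfl fun j _ => ?_
    rw [mul_comm, ← setLIntegral_const]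
    refine setLIntegral_congr_fun (hA j) fun x hx => ?_
    simp only [indicatorVector_eq_single hd hx, hT]
  have h2 : ENNReal.ofReal c * ∑ j, ρ (A j) * T j =
      ENNReal.ofReal c * ∫⁻ d, F d ∂dirichletDistribution a := by
    calc
      _ = ∑ j, ENNReal.ofReal (a j) * T j := by
        rw [Finset.mul_sum]
        refine Finset.sum_congr rfl fun j _ => ?_
        rw [ha_def, ENNReal.ofReal_mul hc.le, ofReal_measureReal, mul_assoc]
      _ = ∑ j, ∫⁻ g, ENNReal.ofReal (g j) * F (fun i => g i / ∑ j, g j)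
            ∂Measure.pi (fun i => gammaLaw (a i)) := by
        refine Finset.sum_congr rfl fun j _ => ?_
        rw [← lintegral_stickLaw_dirichlet_single ha hcs j hF, hsum]
      _ = ∫⁻ g, ENNReal.ofReal (∑ i, g i) * F (fun i => g i / ∑ j, g j)
            ∂Measure.pi (fun i => gammaLaw (a i)) := by
        have hm : ∀ k : Fin n, Measurable fun g : Fin n → ℝ =>
            ENNReal.ofReal (g k) * F (fun i => g i / ∑ j, g j) :=
          fun k => Measurable.mul (by fun_prop) (hF.comp measurable_normalize)
        rw [← lintegral_finsetSum _ fun k _ => hm k]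
        refine lintegral_congr_ae ?_
        filter_upwards [ae_sum_pos_pi_gammaLaw ha hcs] with g hg
        rw [ENNReal.ofReal_sum_of_nonneg fun i _ => hg.1 i, Finset.sum_mul]
      _ = _ := by rw [lintegral_normalize_pi_gammaLaw ha hF, hsum]
  rw [h1]
  exact (ENNReal.mul_right_inj (by simpa using hc) ENNReal.ofReal_ne_top).1 h2

/-! ### Stick breaking and the existence of Dirichlet processes -/

/-- The length of the stick that remains after `n` breaks; the `k`-th break removes the proportion
`(ω k).1`. -/
def stickRemainder (ω : ℕ → ℝ × ℝ) (n : ℕ) : ℝ := ∏ k ∈ Finset.range n, (1 - (ω k).1)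

/-- The length of the `k`-th piece that is broken off. -/
def stickWeight (ω : ℕ → ℝ × ℝ) (k : ℕ) : ℝ := (ω k).1 * stickRemainder ω k

theorem measurable_stickRemainder (n : ℕ) : Measurable fun ω => stickRemainder ω n := by
  unfold stickRemainder
  fun_prop

theorem measurable_stickWeight (k : ℕ) : Measurable fun ω => stickWeight ω k := by
  unfold stickWeight stickRemainder
  fun_prop

theorem sum_stickWeight (ω : ℕ → ℝ × ℝ) (n : ℕ) :
    ∑ k ∈ Finset.range n, stickWeight ω k = 1 - stickRemainder ω n := by
  induction n with
  | zero => simp [stickRemainder]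
  | succ n ih =>
    rw [Finset.sum_range_succ, ih, stickWeight]
    simp only [stickRemainder, Finset.prod_range_succ]
    ring

/-- The measure with mass `stickWeight ω k` at the point `(ω k).2`, for every `k`. -/
noncomputable def stickMeasure (ω : ℕ → ℝ × ℝ) : Measure ℝ :=
  Measure.sum fun k => ENNReal.ofReal (stickWeight ω k) • Measure.dirac (ω k).2

theorem stickMeasure_apply (ω : ℕ → ℝ × ℝ) {s : Set ℝ} (hs : MeasurableSet s) :
    stickMeasure ω s = ∑' k, ENNReal.ofReal (stickWeight ω k) * s.indicator 1 (ω k).2 := by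
  simp [stickMeasure, Measure.sum_apply _ hs, hs]

theorem measurable_stickMeasure : Measurable stickMeasure := by
  refine Measure.measurable_of_measurable_coe _ fun s hs => ?_
  simp_rw [stickMeasure_apply _ hs]
  refine Measurable.tsum fun k => ((measurable_stickWeight k).ennreal_ofReal).mul ?_
  exact (measurable_one.indicator hs).comp (by fun_prop)

open Classical in
/-- The stick-breaking random probability measure; the value is an arbitrary fixed probability
measure where the pieces do not exhaust the stick. -/
noncomputable def stickProcess (ω : ℕ → ℝ × ℝ) : ProbabilityMeasure ℝ :=
  if h : IsProbabilityMeasure (stickMeasure ω) then ⟨stickMeasure ω, h⟩ else diracProba 0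

theorem measurable_stickProcess : Measurable stickProcess := by
  classical
  refine Measurable.subtype_mk (f := fun ω => (stickProcess ω : Measure ℝ)) ?_
  have hcoe : (fun ω => (stickProcess ω : Measure ℝ)) =
      fun ω => if stickMeasure ω Set.univ = 1 then stickMeasure ω else Measure.dirac 0 := by
    ext1 ω
    by_cases h : IsProbabilityMeasure (stickMeasure ω)
    · rw [show stickProcess ω = ⟨stickMeasure ω, h⟩ from dif_pos h, if_pos h.measure_univ]
      rfl
    · rw [show stickProcess ω = diracProba 0 from dif_neg h, if_neg fun h' => h ⟨h'⟩]
      rfl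
  rw [hcoe]
  refine Measurable.ite ?_ measurable_stickMeasure measurable_const
  exact ((Measure.measurable_coe MeasurableSet.univ).comp measurable_stickMeasure)
    (measurableSet_singleton 1)

/-- The law of the breaks and atoms: independent pairs, with independent entries with the laws
`stickLaw c` and `ρ`. -/
noncomputable def stickBreakingLaw (c : ℝ) (ρ : Measure ℝ) : Measure (ℕ → ℝ × ℝ) :=
  Measure.infinitePi fun _ : ℕ => (stickLaw c).prod ρ

theorem isProbabilityMeasure_stickBreakingLaw {c : ℝ} (hc : 0 ≤ c) (ρ : Measure ℝ)
    [IsProbabilityMeasure ρ] : IsProbabilityMeasure (stickBreakingLaw c ρ) := by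
  have := isProbabilityMeasure_stickLaw hc
  unfold stickBreakingLaw
  infer_instance

theorem ae_mem_Ioo_stickBreakingLaw {c : ℝ} (hc : 0 < c) (ρ : Measure ℝ)
    [IsProbabilityMeasure ρ] : ∀ᵐ ω ∂stickBreakingLaw c ρ, ∀ k, (ω k).1 ∈ Set.Ioo (0 : ℝ) 1 := by
  have := isProbabilityMeasure_stickLaw hc.le
  refine ae_all_iff.2 fun k => ?_
  refine (measurePreserving_eval_infinitePi (fun _ : ℕ => (stickLaw c).prod ρ)
    k).quasiMeasurePreserving.ae (p := fun y : ℝ × ℝ => y.1 ∈ Set.Ioo (0 : ℝ) 1) ?_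
  exact Measure.quasiMeasurePreserving_fst.ae (ae_mem_Ioo_stickLaw hc)

/-- The expected remainders form a convergent geometric series, so the remainders tend to `0`. -/
theorem ae_tendsto_stickRemainder {c : ℝ} (hc : 0 < c) (ρ : Measure ℝ)
    [IsProbabilityMeasure ρ] :
    ∀ᵐ ω ∂stickBreakingLaw c ρ, Tendsto (stickRemainder ω) atTop (𝓝 0) := by
  have := isProbabilityMeasure_stickLaw hc.le
  set q : ℝ≥0∞ := ∫⁻ v, ENNReal.ofReal (1 - v) ∂stickLaw c with hq
  have hq1 : q < 1 := by
    have hlt : ∫⁻ v, ENNReal.ofReal (1 - v) ∂stickLaw c < ∫⁻ _, 1 ∂stickLaw c := by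
      refine lintegral_strict_mono (IsProbabilityMeasure.ne_zero _) aemeasurable_const ?_ ?_
      · refine ne_top_of_le_ne_top (b := ∫⁻ _, 1 ∂stickLaw c) (by simp) (lintegral_mono_ae ?_)
        filter_upwards [ae_mem_Ioo_stickLaw hc] with v hv
        simpa using hv.1.le
      · filter_upwards [ae_mem_Ioo_stickLaw hc] with v hv
        simpa using hv.1
    simpa using hlt
  have hm : ∀ k : ℕ, Measurable fun ω : ℕ → ℝ × ℝ => ENNReal.ofReal (1 - (ω k).1) :=
    fun k => by fun_prop
  have hprod : ∀ n, ∫⁻ ω, ∏ k ∈ Finset.range n, ENNReal.ofReal (1 - (ω k).1)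
      ∂stickBreakingLaw c ρ = q ^ n := by
    intro n
    have hy : Measurable fun y : ℝ × ℝ => ENNReal.ofReal (1 - y.1) := by fun_prop
    have hind : iIndepFun (fun (k : ℕ) (ω : ℕ → ℝ × ℝ) => ENNReal.ofReal (1 - (ω k).1))
        (stickBreakingLaw c ρ) :=
      iIndepFun_infinitePi (P := fun _ : ℕ => (stickLaw c).prod ρ)
        (X := fun _ y => ENNReal.ofReal (1 - y.1)) fun _ => hy
    rw [lintegral_prod_eq_prod_lintegral_of_indepFun _ _ hind hm]
    have hk : ∀ k : ℕ, ∫⁻ ω, ENNReal.ofReal (1 - (ω k).1) ∂stickBreakingLaw c ρ = q := by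
      intro k
      rw [stickBreakingLaw, (measurePreserving_eval_infinitePi
        (fun _ : ℕ => (stickLaw c).prod ρ) k).lintegral_comp hy,
        lintegral_prod _ hy.aemeasurable]
      simp [hq]
    simp [hk]
  have hsum : ∫⁻ ω, ∑' n, ∏ k ∈ Finset.range n, ENNReal.ofReal (1 - (ω k).1)
      ∂stickBreakingLaw c ρ ≠ ∞ := by
    rw [lintegral_tsum fun n => (Finset.measurable_fun_prod _ fun k _ => hm k).aemeasurable]
    simp_rw [hprod, ENNReal.tsum_geometric]
    exact ENNReal.inv_ne_top.2 (tsub_pos_of_lt hq1).ne'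
  have hfin := ae_lt_top (Measurable.tsum fun n =>
    Finset.measurable_fun_prod (Finset.range n) fun k _ => hm k) hsum
  filter_upwards [hfin, ae_mem_Ioo_stickBreakingLaw hc ρ] with ω hω hv
  have h0 := ENNReal.tendsto_atTop_zero_of_tsum_ne_top hω.ne
  rw [← ENNReal.tendsto_toReal_zero_iff (fun n => by
    exact ENNReal.prod_ne_top fun k _ => ENNReal.ofReal_ne_top)] at h0
  refine h0.congr fun n => ?_
  rw [ENNReal.toReal_prod]
  exact Finset.prod_congr rfl fun k _ => ENNReal.toReal_ofReal (by linarith [(hv k).2])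

theorem stickRemainder_update (ω : ℕ → ℝ × ℝ) {k n : ℕ} (hk : k ≤ n) (y : ℝ × ℝ) :
    stickRemainder (Function.update ω n y) k = stickRemainder ω k := by
  refine Finset.prod_congr rfl fun i hi => ?_
  rw [Function.update_of_ne]
  have := Finset.mem_range.1 hi
  omega

theorem stickWeight_update (ω : ℕ → ℝ × ℝ) {k n : ℕ} (hk : k < n) (y : ℝ × ℝ) :
    stickWeight (Function.update ω n y) k = stickWeight ω k := by
  rw [stickWeight, stickRemainder_update ω hk.le, Function.update_of_ne hk.ne, stickWeight]

/-- The masses that the first `n` atoms give to the sets `A i`. -/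
noncomputable def stickPartialVector {m : ℕ} (A : Fin m → Set ℝ) (ω : ℕ → ℝ × ℝ) (n : ℕ) :
    Fin m → ℝ :=
  ∑ k ∈ Finset.range n, stickWeight ω k • indicatorVector A (ω k).2

theorem measurable_stickPartialVector {m : ℕ} {A : Fin m → Set ℝ}
    (hA : ∀ i, MeasurableSet (A i)) (n : ℕ) : Measurable fun ω => stickPartialVector A ω n := by
  refine Finset.measurable_fun_sum _ fun k _ => (measurable_stickWeight k).smul ?_
  exact (measurable_indicatorVector hA).comp (by fun_prop)

/-- Filling the remainder of the stick with an independent Dirichlet vector gives a Dirichlet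
vector, after every number of breaks. -/
theorem lintegral_stickPartialVector {m : ℕ} {A : Fin m → Set ℝ}
    (hA : ∀ i, MeasurableSet (A i)) (hd : Pairwise (Function.onFun Disjoint A))
    (hU : ⋃ i, A i = Set.univ) (ρ : Measure ℝ) [IsProbabilityMeasure ρ] {c : ℝ} (hc : 0 < c)
    {F : (Fin m → ℝ) → ℝ≥0∞} (hF : Measurable F) (n : ℕ) :
    ∫⁻ ω, ∫⁻ d, F (stickPartialVector A ω n + stickRemainder ω n • d)
        ∂dirichletDistribution (fun i => c * ρ.real (A i)) ∂stickBreakingLaw c ρ =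
      ∫⁻ d, F d ∂dirichletDistribution fun i => c * ρ.real (A i) := by
  have := isProbabilityMeasure_stickLaw hc.le
  have := isProbabilityMeasure_stickBreakingLaw hc.le ρ
  set a : Fin m → ℝ := fun i => c * ρ.real (A i) with ha_def
  have ha : ∀ i, 0 ≤ a i := fun i => mul_nonneg hc.le measureReal_nonneg
  have := isProbabilityMeasure_dirichletDistribution ha
  have hI := measurable_indicatorVector hA
  induction n with
  | zero => simp [stickPartialVector, stickRemainder]
  | succ n ih =>
    -- Resampling the pair with index `n` reduces the step to the fixed point equation for `d`.
    have hG : Measurable fun p : (ℕ → ℝ × ℝ) × (Fin m → ℝ) =>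
        F (stickPartialVector A p.1 (n + 1) + stickRemainder p.1 (n + 1) • p.2) :=
      hF.comp (((measurable_stickPartialVector hA _).comp measurable_fst).add
        (((measurable_stickRemainder _).comp measurable_fst).smul measurable_snd))
    rw [← ih, stickBreakingLaw, lintegral_infinitePi_update _ n hG.lintegral_prod_right']
    refine lintegral_congr fun ω => ?_
    have hup : ∀ y : ℝ × ℝ, ∀ d : Fin m → ℝ,
        stickPartialVector A (Function.update ω n y) (n + 1) +
          stickRemainder (Function.update ω n y) (n + 1) • d =
        stickPartialVector A ω n + stickRemainder ω n •
          (y.1 • indicatorVector A y.2 + (1 - y.1) • d) := by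
      intro y d
      have h1 : stickPartialVector A (Function.update ω n y) (n + 1) =
          stickPartialVector A ω n + (y.1 * stickRemainder ω n) • indicatorVector A y.2 := by
        rw [stickPartialVector, Finset.sum_range_succ, stickWeight,
          stickRemainder_update ω le_rfl, Function.update_self, stickPartialVector]
        congr 1
        refine Finset.sum_congr rfl fun k hk => ?_
        have hk := Finset.mem_range.1 hk
        rw [stickWeight_update ω hk, Function.update_of_ne hk.ne]
      have h2 : stickRemainder (Function.update ω n y) (n + 1) =
          stickRemainder ω n * (1 - y.1) := by
        rw [stickRemainder, Finset.prod_range_succ, Function.update_self]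
        congr 1
        exact stickRemainder_update ω le_rfl y
      rw [h1, h2, smul_add, smul_smul, smul_smul, add_assoc, mul_comm y.1]
    simp_rw [hup]
    set F' : (Fin m → ℝ) → ℝ≥0∞ := fun z => F (stickPartialVector A ω n + stickRemainder ω n • z)
      with hF'_def
    have hF' : Measurable F' := hF.comp (by fun_prop)
    rw [← lintegral_dirichlet_fixed_point hA hd hU ρ hc hF']
    refine lintegral_prod_symm (fun y : ℝ × ℝ => ∫⁻ d, F' (y.1 • indicatorVector A y.2 +
      (1 - y.1) • d) ∂dirichletDistribution a) ?_
    refine (Measurable.lintegral_prod_right' (f := fun p : (ℝ × ℝ) × (Fin m → ℝ) =>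
      F' (p.1.1 • indicatorVector A p.1.2 + (1 - p.1.1) • p.2)) ?_).aemeasurable
    exact hF'.comp (by fun_prop)

theorem isProbabilityMeasure_stickMeasure {ω : ℕ → ℝ × ℝ} (hω : ∀ k, 0 ≤ stickWeight ω k)
    (hr : Tendsto (stickRemainder ω) atTop (𝓝 0)) : IsProbabilityMeasure (stickMeasure ω) := by
  have hs : HasSum (stickWeight ω) 1 := by
    rw [hasSum_iff_tendsto_nat_of_nonneg hω]
    simp_rw [sum_stickWeight]
    simpa using hr.const_sub 1
  refine ⟨?_⟩
  rw [stickMeasure_apply ω MeasurableSet.univ]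
  simp [← ENNReal.ofReal_tsum_of_nonneg hω hs.summable, hs.tsum_eq]

theorem tendsto_stickPartialVector {m : ℕ} {A : Fin m → Set ℝ}
    (hA : ∀ i, MeasurableSet (A i)) {ω : ℕ → ℝ × ℝ} (hω : ∀ k, 0 ≤ stickWeight ω k)
    (hr : Tendsto (stickRemainder ω) atTop (𝓝 0)) :
    Tendsto (stickPartialVector A ω) atTop
      (𝓝 fun i => (stickProcess ω : Measure ℝ).real (A i)) := by
  have hs : HasSum (stickWeight ω) 1 := by
    rw [hasSum_iff_tendsto_nat_of_nonneg hω]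
    simp_rw [sum_stickWeight]
    simpa using hr.const_sub 1
  have hP := isProbabilityMeasure_stickMeasure hω hr
  have hcoe : (stickProcess ω : Measure ℝ) = stickMeasure ω := by
    rw [show stickProcess ω = ⟨stickMeasure ω, hP⟩ from dif_pos hP]
    rfl
  refine tendsto_pi_nhds.2 fun i => ?_
  have hle : ∀ k, stickWeight ω k * indicatorVector A (ω k).2 i ≤ stickWeight ω k := fun k =>
    mul_le_of_le_one_right (hω k) (by
      unfold indicatorVector Set.indicator
      split_ifs <;> simp)
  have hnn : ∀ k, 0 ≤ stickWeight ω k * indicatorVector A (ω k).2 i := fun k =>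
    mul_nonneg (hω k) (Set.indicator_nonneg (fun _ _ => zero_le_one) _)
  have hsm := Summable.of_nonneg_of_le hnn hle hs.summable
  have hval : (stickMeasure ω).real (A i) =
      ∑' k, stickWeight ω k * indicatorVector A (ω k).2 i := by
    rw [measureReal_def, stickMeasure_apply ω (hA i),
      ← ENNReal.toReal_ofReal (tsum_nonneg hnn), ENNReal.ofReal_tsum_of_nonneg hnn hsm]
    congr 1
    refine tsum_congr fun k => ?_
    rw [ENNReal.ofReal_mul (hω k)]
    congr 1
    by_cases hk : (ω k).2 ∈ A i <;> simp [indicatorVector, hk]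
  rw [hcoe, hval]
  refine hsm.hasSum.tendsto_sum_nat.congr fun n => ?_
  simp [stickPartialVector]

theorem map_stickProcess_partition {m : ℕ} {A : Fin m → Set ℝ}
    (hA : ∀ i, MeasurableSet (A i)) (hd : Pairwise (Function.onFun Disjoint A))
    (hU : ⋃ i, A i = Set.univ) (ρ : Measure ℝ) [IsProbabilityMeasure ρ] {c : ℝ} (hc : 0 < c) :
    (stickBreakingLaw c ρ).map (fun ω i => (stickProcess ω : Measure ℝ).real (A i)) =
      dirichletDistribution fun i => c * ρ.real (A i) := by
  have := isProbabilityMeasure_stickBreakingLaw hc.le ρ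
  set a : Fin m → ℝ := fun i => c * ρ.real (A i) with ha_def
  have ha : ∀ i, 0 ≤ a i := fun i => mul_nonneg hc.le measureReal_nonneg
  have := isProbabilityMeasure_dirichletDistribution ha
  have hpm : Measurable fun (ω : ℕ → ℝ × ℝ) i => (stickProcess ω : Measure ℝ).real (A i) :=
    measurable_pi_lambda _ fun i => ((Measure.measurable_coe (hA i)).comp
      (measurable_subtype_coe.comp measurable_stickProcess)).ennreal_toReal
  have := Measure.isProbabilityMeasure_map (μ := stickBreakingLaw c ρ) hpm.aemeasurable
  refine ext_of_forall_lintegral_eq_of_IsFiniteMeasure fun f => ?_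
  have hfm : Measurable fun x : Fin m → ℝ => (f x : ℝ≥0∞) :=
    f.continuous.measurable.coe_nnreal_ennreal
  rw [lintegral_map hfm hpm]
  have hZm : ∀ n, Measurable fun p : (ℕ → ℝ × ℝ) × (Fin m → ℝ) =>
      (f (stickPartialVector A p.1 n + stickRemainder p.1 n • p.2) : ℝ≥0∞) := fun n =>
    hfm.comp (((measurable_stickPartialVector hA _).comp measurable_fst).add
      (((measurable_stickRemainder _).comp measurable_fst).smul measurable_snd))
  have hlim : Tendsto (fun n => ∫⁻ p, f (stickPartialVector A p.1 n + stickRemainder p.1 n • p.2)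
      ∂(stickBreakingLaw c ρ).prod (dirichletDistribution a)) atTop
      (𝓝 (∫⁻ p, f (fun i => (stickProcess p.1 : Measure ℝ).real (A i))
        ∂(stickBreakingLaw c ρ).prod (dirichletDistribution a))) := by
    refine tendsto_lintegral_of_dominated_convergence (fun _ => ((nndist f 0 : ℝ≥0) : ℝ≥0∞)) hZm
      (fun n => ae_of_all _ fun p => ?_) (by simp) ?_
    · exact ENNReal.coe_le_coe.2 (BoundedContinuousFunction.NNReal.upper_bound f _)
    · filter_upwards [Measure.quasiMeasurePreserving_fst.ae (ae_mem_Ioo_stickBreakingLaw hc ρ),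
        Measure.quasiMeasurePreserving_fst.ae (ae_tendsto_stickRemainder hc ρ)] with p hv hr
      have hω : ∀ k, 0 ≤ stickWeight p.1 k := fun k =>
        mul_nonneg (hv k).1.le (Finset.prod_nonneg fun i _ => by linarith [(hv i).2])
      refine ENNReal.tendsto_coe.2 ((f.continuous.tendsto _).comp ?_)
      simpa using (tendsto_stickPartialVector hA hω hr).add (hr.smul_const p.2)
  have hconst : ∀ n, ∫⁻ p, f (stickPartialVector A p.1 n + stickRemainder p.1 n • p.2)
      ∂(stickBreakingLaw c ρ).prod (dirichletDistribution a) =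
      ∫⁻ d, f d ∂dirichletDistribution a := by
    intro n
    rw [lintegral_prod _ (hZm n).aemeasurable]
    exact lintegral_stickPartialVector hA hd hU ρ hc hfm n
  simp_rw [hconst] at hlim
  have hfin := tendsto_nhds_unique tendsto_const_nhds hlim
  rw [hfin]
  exact (measurePreserving_fst.lintegral_comp (hfm.comp hpm)).symm

theorem exists_isDirichletProcess (ρ : ProbabilityMeasure ℝ) {c : ℝ} (hc : 0 < c) :
    ∃ D : Measure (ProbabilityMeasure ℝ),
      IsProbabilityMeasure D ∧ IsDirichletProcess id ρ c D := by
  have := isProbabilityMeasure_stickBreakingLaw hc.le (ρ : Measure ℝ)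
  refine ⟨(stickBreakingLaw c ρ).map stickProcess,
    Measure.isProbabilityMeasure_map measurable_stickProcess.aemeasurable, aemeasurable_id,
    fun n A hA hd hU => ?_⟩
  have hm : Measurable fun (P : ProbabilityMeasure ℝ) i => (P : Measure ℝ).real (A i) :=
    measurable_pi_lambda _ fun i =>
      ((Measure.measurable_coe (hA i)).comp measurable_subtype_coe).ennreal_toReal
  refine ⟨hm.aemeasurable, ?_⟩
  rw [← map_stickProcess_partition hA hd hU (ρ : Measure ℝ) hc]
  exact Measure.map_map hm measurable_stickProcess

/-! ### The gamma transform of random probability measures -/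

/-- The function `y ↦ log (1 - i y)`; the characteristic function of the gamma law of shape `a` is
`exp (-a * logSymbol y)`. -/
noncomputable def logSymbol (y : ℝ) : ℂ := Complex.log (1 - y * Complex.I)

theorem charFun_gammaLaw_eq_exp_logSymbol {a : ℝ} (ha : 0 ≤ a) (y : ℝ) :
    charFun (gammaLaw a) y = Complex.exp (-(a * logSymbol y)) := by
  rw [charFun_gammaLaw ha, neg_mul, logSymbol]

theorem continuous_logSymbol : Continuous logSymbol := by
  refine Continuous.clog (by fun_prop) fun y => Or.inl ?_
  simp

theorem exists_norm_logSymbol_le (M : ℝ) : ∃ C, ∀ y : ℝ, ‖y‖ ≤ M → ‖logSymbol y‖ ≤ C := by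
  obtain ⟨C, hC⟩ := (isCompact_closedBall (0 : ℝ) M).exists_bound_of_continuousOn
    continuous_logSymbol.continuousOn
  exact ⟨C, fun y hy => hC y (by simpa using hy)⟩

theorem continuous_charFun_gammaLaw {a : ℝ} (ha : 0 ≤ a) : Continuous (charFun (gammaLaw a)) := by
  have h : charFun (gammaLaw a) = fun y => Complex.exp (-(a * logSymbol y)) :=
    funext (charFun_gammaLaw_eq_exp_logSymbol ha)
  rw [h]
  have := continuous_logSymbol
  fun_prop

theorem integral_charFun_dirichletDistribution {n : ℕ} {a : Fin n → ℝ} (ha : ∀ i, 0 ≤ a i)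
    (hc : 0 < ∑ i, a i) (t : Fin n → ℝ) :
    ∫ d, charFun (gammaLaw (∑ i, a i)) (∑ i, d i * t i) ∂dirichletDistribution a =
      Complex.exp (-∑ i, a i * logSymbol (t i)) := by
  have := isProbabilityMeasure_dirichletDistribution ha
  have := isProbabilityMeasure_gammaLaw hc.le
  have := fun i => isProbabilityMeasure_gammaLaw (ha i)
  have hm : Measurable fun g : Fin n → ℝ => Complex.exp ((∑ i, t i * g i : ℝ) * Complex.I) := by
    fun_prop
  have hint : Integrable (fun p : ℝ × (Fin n → ℝ) =>
      Complex.exp ((∑ i, t i * (p.1 • p.2) i : ℝ) * Complex.I))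
      ((gammaLaw (∑ i, a i)).prod (dirichletDistribution a)) := by
    refine Integrable.of_bound (by fun_prop) 1 (ae_of_all _ fun p => ?_)
    rw [Complex.norm_exp_ofReal_mul_I]
  calc
    _ = ∫ d, ∫ s, Complex.exp ((∑ i, t i * (s • d) i : ℝ) * Complex.I) ∂gammaLaw (∑ i, a i)
          ∂dirichletDistribution a := by
      refine integral_congr_ae (ae_of_all _ fun d => ?_)
      simp only [charFun_apply_real]
      refine integral_congr_ae (ae_of_all _ fun s => ?_)
      simp only [Pi.smul_apply, smul_eq_mul]
      rw [← Complex.ofReal_mul, Finset.sum_mul]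
      congr 3
      exact Finset.sum_congr rfl fun i _ => by ring
    _ = ∫ g, Complex.exp ((∑ i, t i * g i : ℝ) * Complex.I)
          ∂Measure.pi fun i => gammaLaw (a i) := by
      rw [← map_smul_gammaLaw_prod_dirichletDistribution ha hc,
        integral_map (by fun_prop) hm.aestronglyMeasurable, integral_prod_symm _ hint]
    _ = ∫ g, ∏ i, Complex.exp ((t i : ℂ) * (g i : ℝ) * Complex.I)
          ∂Measure.pi fun i => gammaLaw (a i) := by
      refine integral_congr_ae (ae_of_all _ fun g => ?_)
      simp only []
      rw [← Complex.exp_sum, ← Finset.sum_mul]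
      push_cast
      rfl
    _ = ∏ i, charFun (gammaLaw (a i)) (t i) := by
      rw [integral_fintype_prod_eq_prod (fun (i : Fin n) (x : ℝ) =>
        Complex.exp ((t i : ℂ) * (x : ℝ) * Complex.I))]
      exact Finset.prod_congr rfl fun i _ => (charFun_apply_real _).symm
    _ = _ := by
      simp_rw [charFun_gammaLaw_eq_exp_logSymbol (ha _), ← Complex.exp_sum]
      rw [Finset.sum_neg_distrib]

theorem integral_of_const_on_partition {E : Type*} [NormedAddCommGroup E] [NormedSpace ℝ E]
    [CompleteSpace E] {n : ℕ} {A : Fin n → Set ℝ} (hA : ∀ i, MeasurableSet (A i))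
    (hd : Pairwise (Function.onFun Disjoint A)) (hU : ⋃ i, A i = Set.univ) (μ : Measure ℝ)
    [IsProbabilityMeasure μ] {φ : ℝ → E} {t : Fin n → E} (h : ∀ i, ∀ x ∈ A i, φ x = t i) :
    ∫ x, φ x ∂μ = ∑ i, μ.real (A i) • t i := by
  rw [← setIntegral_univ, ← hU, integral_iUnion_fintype hA hd fun i => ?_]
  · refine Finset.sum_congr rfl fun i _ => ?_
    rw [setIntegral_congr_fun (hA i) (h i), setIntegral_const]
  · exact (integrableOn_congr_fun (h i) (hA i)).2 (integrable_const _).integrableOn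

theorem measurable_integral_probabilityMeasure {g : ℝ → ℝ} (hg : Measurable g) :
    Measurable fun P : ProbabilityMeasure ℝ => ∫ x, g x ∂(P : Measure ℝ) :=
  (StronglyMeasurable.integral_kernel (κ := ⟨fun P : ProbabilityMeasure ℝ => (P : Measure ℝ),
    measurable_subtype_coe⟩) hg.stronglyMeasurable).measurable

theorem IsDirichletProcess.integral_charFun_simpleFunc {Ω : Type*} [MeasurableSpace Ω]
    {P : Ω → ProbabilityMeasure ℝ} {ρ : ProbabilityMeasure ℝ} {c : ℝ} {Q : Measure Ω}
    (h : IsDirichletProcess P ρ c Q) (hc : 0 < c) (g : SimpleFunc ℝ ℝ) :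
    ∫ ω, charFun (gammaLaw c) (∫ x, g x ∂(P ω : Measure ℝ)) ∂Q =
      Complex.exp (-(c * ∫ x, logSymbol (g x) ∂(ρ : Measure ℝ))) := by
  set e := g.range.equivFin.symm with he
  set A : Fin _ → Set ℝ := fun i => g ⁻¹' {(e i : ℝ)} with hA_def
  have hA : ∀ i, MeasurableSet (A i) := fun i => g.measurableSet_fiber _
  have hd : Pairwise (Function.onFun Disjoint A) := by
    intro i j hij
    refine Set.disjoint_left.2 fun x hi hj => hij (e.injective (Subtype.ext ?_))
    rw [← show g x = e i from hi, ← show g x = e j from hj]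
  have hU : ⋃ i, A i = Set.univ := by
    refine Set.eq_univ_of_forall fun x => Set.mem_iUnion.2 ?_
    obtain ⟨i, hi⟩ := e.surjective ⟨g x, g.mem_range_self x⟩
    exact ⟨i, by simp [hA_def, hi]⟩
  set a := fun i => c * (ρ : Measure ℝ).real (A i) with ha_def
  have ha : ∀ i, 0 ≤ a i := fun i => mul_nonneg hc.le measureReal_nonneg
  have hsum : ∑ i, a i = c := by
    rw [ha_def, ← Finset.mul_sum, sum_measureReal_partition hA hd hU, mul_one]
  have hcs : 0 < ∑ i, a i := hsum ▸ hc
  have hlaw := h.hasLaw_partition _ A hA hd hU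
  have hint : ∀ μ : ProbabilityMeasure ℝ,
      ∫ x, g x ∂(μ : Measure ℝ) = ∑ i, (μ : Measure ℝ).real (A i) * e i := fun μ =>
    integral_of_const_on_partition hA hd hU _ fun i x hx => hx
  have hlog : ∫ x, logSymbol (g x) ∂(ρ : Measure ℝ) =
      ∑ i, (ρ : Measure ℝ).real (A i) • logSymbol (e i) :=
    integral_of_const_on_partition hA hd hU _ fun i x hx => by
      rw [show g x = e i from hx]
  have hD := integral_charFun_dirichletDistribution ha hcs fun i => (e i : ℝ)
  rw [hsum, ← hlaw.integral_comp (f := fun d => charFun (gammaLaw c) (∑ i, d i * (e i : ℝ)))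
    ((continuous_charFun_gammaLaw hc.le).measurable.comp
      (by fun_prop)).aestronglyMeasurable] at hD
  simp_rw [hint]
  refine hD.trans ?_
  rw [hlog, Finset.mul_sum]
  congr 2
  refine Finset.sum_congr rfl fun i _ => ?_
  rw [ha_def, Complex.real_smul]
  push_cast
  ring

/-- The gamma transform of a Dirichlet process. It follows from the case of simple functions, where
it is an identity for Dirichlet distributions, by dominated convergence. -/
theorem IsDirichletProcess.integral_charFun {Ω : Type*} [MeasurableSpace Ω]
    {P : Ω → ProbabilityMeasure ℝ} {ρ : ProbabilityMeasure ℝ} {c : ℝ} {Q : Measure Ω}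
    [IsProbabilityMeasure Q]
    (h : IsDirichletProcess P ρ c Q) (hc : 0 < c) (f : BoundedContinuousFunction ℝ ℝ) :
    ∫ ω, charFun (gammaLaw c) (∫ x, f x ∂(P ω : Measure ℝ)) ∂Q =
      Complex.exp (-(c * ∫ x, logSymbol (f x) ∂(ρ : Measure ℝ))) := by
  have := isProbabilityMeasure_gammaLaw hc.le
  have hf : StronglyMeasurable f := f.continuous.stronglyMeasurable
  set g : ℕ → SimpleFunc ℝ ℝ := hf.approxBounded ‖f‖ with hg
  have hgb : ∀ n x, ‖g n x‖ ≤ ‖f‖ := hf.norm_approxBounded_le (norm_nonneg f)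
  have hgt : ∀ x, Tendsto (fun n => g n x) atTop (𝓝 (f x)) := fun x =>
    hf.tendsto_approxBounded_of_norm_le (f.norm_coe_le_norm x)
  have hint : ∀ μ : ProbabilityMeasure ℝ, Tendsto (fun n => ∫ x, g n x ∂(μ : Measure ℝ)) atTop
      (𝓝 (∫ x, f x ∂(μ : Measure ℝ))) := fun μ =>
    tendsto_integral_of_dominated_convergence (fun _ => ‖f‖)
      (fun n => (g n).measurable.aestronglyMeasurable) (integrable_const _)
      (fun n => ae_of_all _ (hgb n)) (ae_of_all _ hgt)
  have hcont := continuous_charFun_gammaLaw hc.le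
  have h1 : Tendsto (fun n => ∫ ω, charFun (gammaLaw c) (∫ x, g n x ∂(P ω : Measure ℝ)) ∂Q) atTop
      (𝓝 (∫ ω, charFun (gammaLaw c) (∫ x, f x ∂(P ω : Measure ℝ)) ∂Q)) :=
    tendsto_integral_of_dominated_convergence (fun _ => 1)
      (fun n => (hcont.measurable.comp_aemeasurable
        ((measurable_integral_probabilityMeasure (g n).measurable).comp_aemeasurable
          h.aemeasurable)).aestronglyMeasurable) (integrable_const _)
      (fun n => ae_of_all _ fun ω => norm_charFun_le_one _)
      (ae_of_all _ fun ω => (hcont.tendsto _).comp (hint (P ω)))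
  obtain ⟨C, hC⟩ := exists_norm_logSymbol_le ‖f‖
  have h2 : Tendsto (fun n => ∫ x, logSymbol (g n x) ∂(ρ : Measure ℝ)) atTop
      (𝓝 (∫ x, logSymbol (f x) ∂(ρ : Measure ℝ))) :=
    tendsto_integral_of_dominated_convergence (fun _ => C)
      (fun n => (continuous_logSymbol.measurable.comp (g n).measurable).aestronglyMeasurable)
      (integrable_const _) (fun n => ae_of_all _ fun x => hC _ (hgb n x))
      (ae_of_all _ fun x => (continuous_logSymbol.tendsto _).comp (hgt x))
  simp_rw [h.integral_charFun_simpleFunc hc] at h1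
  exact tendsto_nhds_unique h1
    ((Complex.continuous_exp.tendsto _).comp (h2.const_mul (c : ℂ)).neg)

/-! ### A criterion for weak convergence of laws of random probability measures -/

theorem continuous_integral_probabilityMeasure (f : BoundedContinuousFunction ℝ ℝ) :
    Continuous fun P : ProbabilityMeasure ℝ => ∫ x, f x ∂(P : Measure ℝ) :=
  continuous_iff_continuousAt.2 fun _ =>
    ProbabilityMeasure.tendsto_iff_forall_integral_tendsto.1 tendsto_id f

/-- The integrals of finitely many test functions. -/
noncomputable def integralVector {ι : Type*} (f : ι → BoundedContinuousFunction ℝ ℝ)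
    (P : ProbabilityMeasure ℝ) (i : ι) : ℝ :=
  ∫ x, f i x ∂(P : Measure ℝ)

theorem continuous_integralVector {ι : Type*} (f : ι → BoundedContinuousFunction ℝ ℝ) :
    Continuous (integralVector f) :=
  continuous_pi fun i => continuous_integral_probabilityMeasure (f i)

/-- The weak topology is induced by the integrals of all bounded continuous functions. -/
theorem isInducing_integralVector :
    IsInducing (integralVector (id : BoundedContinuousFunction ℝ ℝ → _)) := by
  refine isInducing_iff_nhds.2 fun P => le_antisymm
    ((continuous_integralVector _).tendsto P).le_comap ?_
  have hid : Tendsto id (comap (integralVector (id : BoundedContinuousFunction ℝ ℝ → _))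
      (𝓝 (integralVector id P))) (𝓝 P) :=
    ProbabilityMeasure.tendsto_iff_forall_integral_tendsto.2 fun f =>
      ((continuous_apply f).tendsto (integralVector id P)).comp tendsto_comap
  exact hid

/-- The sets of probability measures that are described by an open condition on the integrals of
finitely many bounded continuous functions. -/
def IsIntegralCylinder (G : Set (ProbabilityMeasure ℝ)) : Prop :=
  ∃ (s : Finset (BoundedContinuousFunction ℝ ℝ)) (U : Set (s → ℝ)), IsOpen U ∧
    G = integralVector (fun f : s => (f : BoundedContinuousFunction ℝ ℝ)) ⁻¹' U

theorem IsIntegralCylinder.isOpen {G : Set (ProbabilityMeasure ℝ)} (hG : IsIntegralCylinder G) :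
    IsOpen G := by
  obtain ⟨s, U, hU, rfl⟩ := hG
  exact hU.preimage (continuous_integralVector _)

theorem IsIntegralCylinder.union {G H : Set (ProbabilityMeasure ℝ)} (hG : IsIntegralCylinder G)
    (hH : IsIntegralCylinder H) : IsIntegralCylinder (G ∪ H) := by
  classical
  obtain ⟨s, U, hU, rfl⟩ := hG
  obtain ⟨t, V, hV, rfl⟩ := hH
  refine ⟨s ∪ t, ((fun x (i : s) => x ⟨i, Finset.mem_union_left t i.2⟩) ⁻¹' U) ∪
    ((fun x (i : t) => x ⟨i, Finset.mem_union_right s i.2⟩) ⁻¹' V), ?_, rfl⟩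
  exact (hU.preimage (by fun_prop)).union (hV.preimage (by fun_prop))

theorem exists_isIntegralCylinder_subset {G : Set (ProbabilityMeasure ℝ)} (hG : IsOpen G)
    {P : ProbabilityMeasure ℝ} (hP : P ∈ G) : ∃ H, IsIntegralCylinder H ∧ P ∈ H ∧ H ⊆ G := by
  obtain ⟨W, hW, rfl⟩ := isInducing_integralVector.isOpen_iff.1 hG
  obtain ⟨s, u, hu, hsub⟩ := isOpen_pi_iff.1 hW _ hP
  refine ⟨_, ⟨s, Set.univ.pi fun f => u f, isOpen_set_pi Set.finite_univ fun f _ => (hu f f.2).1,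
    rfl⟩, fun f _ => (hu f f.2).2, fun P' hP' => hsub fun f hf => ?_⟩
  exact hP' ⟨f, hf⟩ (Set.mem_univ _)

theorem secondCountableTopology_probabilityMeasure :
    SecondCountableTopology (ProbabilityMeasure ℝ) :=
  ⟨⟨weakSubbasis, weakSubbasis_countable, weakSubbasis_generates⟩⟩

theorem exists_seq_isIntegralCylinder {G : Set (ProbabilityMeasure ℝ)} (hG : IsOpen G)
    (hne : G.Nonempty) :
    ∃ H : ℕ → Set (ProbabilityMeasure ℝ), (∀ n, IsIntegralCylinder (H n)) ∧ ⋃ n, H n = G := by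
  have := secondCountableTopology_probabilityMeasure
  choose! N hNc hNm hNs using fun P (hP : P ∈ G) => exists_isIntegralCylinder_subset hG hP
  obtain ⟨T, hTG, hTc, hT⟩ := TopologicalSpace.isOpen_biUnion_countable G N
    fun P hP => (hNc P hP).isOpen
  have hGN : ⋃ P ∈ G, N P = G := by
    refine Set.Subset.antisymm (Set.iUnion₂_subset hNs) fun P hP => ?_
    exact Set.mem_biUnion hP (hNm P hP)
  rw [hGN] at hT
  have hTne : T.Nonempty := by
    rw [Set.nonempty_iff_ne_empty]
    rintro rfl
    simp only [Set.mem_empty_iff_false, Set.iUnion_of_empty, Set.iUnion_empty] at hT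
    exact hne.ne_empty hT.symm
  obtain ⟨u, rfl⟩ := hTc.exists_eq_range hTne
  refine ⟨fun n => N (u n), fun n => hNc _ (hTG ⟨n, rfl⟩), ?_⟩
  rwa [Set.biUnion_range] at hT

/-- Weak convergence on the space of probability measures can be tested on the sets described by
finitely many integrals. -/
theorem tendsto_of_forall_isIntegralCylinder {D : ℕ → ProbabilityMeasure (ProbabilityMeasure ℝ)}
    {D₀ : ProbabilityMeasure (ProbabilityMeasure ℝ)}
    (h : ∀ G, IsIntegralCylinder G →
      (D₀ : Measure (ProbabilityMeasure ℝ)) G ≤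
        liminf (fun N => (D N : Measure (ProbabilityMeasure ℝ)) G) atTop) :
    Tendsto D atTop (𝓝 D₀) := by
  refine tendsto_of_forall_isOpen_le_liminf' fun G hG => ?_
  rcases G.eq_empty_or_nonempty with rfl | hne
  · simp
  obtain ⟨H, hH, rfl⟩ := exists_seq_isIntegralCylinder hG hne
  rw [measure_iUnion_eq_iSup_accumulate]
  refine iSup_le fun n => ?_
  have hacc : IsIntegralCylinder (Set.accumulate H n) := by
    induction n with
    | zero => simpa [Set.accumulate] using hH 0
    | succ n ih => rw [Set.accumulate_succ]; exact ih.union (hH _)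
  refine (h _ hacc).trans (liminf_le_liminf (Eventually.of_forall fun N => measure_mono ?_))
  exact Set.accumulate_subset_iUnion n

/-- The vector of the integrals of the test functions `f i` against `s • P`, together with the total
mass `s`. -/
noncomputable def scaledIntegralVector {ι : Type*} [Fintype ι]
    (f : ι → BoundedContinuousFunction ℝ ℝ) (p : ℝ × ProbabilityMeasure ℝ) :
    EuclideanSpace ℝ (Option ι) :=
  WithLp.toLp 2 fun o => o.elim p.1 fun i => p.1 * integralVector f p.2 i

theorem measurable_scaledIntegralVector {ι : Type*} [Fintype ι]
    (f : ι → BoundedContinuousFunction ℝ ℝ) : Measurable (scaledIntegralVector f) := by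
  refine (WithLp.measurable_toLp 2 _).comp (measurable_pi_lambda _ fun o => ?_)
  rcases o with _ | i
  · exact measurable_fst
  · exact measurable_fst.mul ((measurable_integral_probabilityMeasure
      (f i).continuous.measurable).comp measurable_snd)

theorem charFun_map_scaledIntegralVector {ι : Type*} [Fintype ι]
    (f : ι → BoundedContinuousFunction ℝ ℝ) (γ : Measure ℝ) [IsProbabilityMeasure γ]
    (D : Measure (ProbabilityMeasure ℝ)) [IsProbabilityMeasure D]
    (t : EuclideanSpace ℝ (Option ι)) :
    charFun ((γ.prod D).map (scaledIntegralVector f)) t =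
      ∫ P, charFun γ (∫ x, (BoundedContinuousFunction.const ℝ (t none) +
        ∑ i, t (some i) • f i : BoundedContinuousFunction ℝ ℝ) x ∂(P : Measure ℝ)) ∂D := by
  have hm := measurable_scaledIntegralVector f
  have hin : ∀ p : ℝ × ProbabilityMeasure ℝ, inner ℝ (scaledIntegralVector f p) t =
      (∫ x, (BoundedContinuousFunction.const ℝ (t none) +
        ∑ i, t (some i) • f i : BoundedContinuousFunction ℝ ℝ) x ∂(p.2 : Measure ℝ)) * p.1 := by
    intro p
    have hint : ∫ x, (BoundedContinuousFunction.const ℝ (t none) +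
        ∑ i, t (some i) • f i : BoundedContinuousFunction ℝ ℝ) x ∂(p.2 : Measure ℝ) =
        t none + ∑ i, t (some i) * integralVector f p.2 i := by
      simp only [BoundedContinuousFunction.coe_add, Pi.add_apply,
        BoundedContinuousFunction.const_apply, BoundedContinuousFunction.coe_sum,
        Finset.sum_apply, BoundedContinuousFunction.coe_smul, smul_eq_mul]
      rw [integral_add (integrable_const _) (integrable_finsetSum _ fun i _ =>
        ((f i).integrable _).const_mul _), integral_finsetSum _ fun i _ =>
        ((f i).integrable _).const_mul _]
      simp [integral_const_mul, integralVector]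
    rw [hint, PiLp.inner_apply, Fintype.sum_option]
    simp only [scaledIntegralVector, Option.elim, RCLike.inner_apply, conj_trivial]
    rw [add_mul, Finset.sum_mul]
    congr 1
    exact Finset.sum_congr rfl fun i _ => by ring
  rw [charFun_apply, integral_map hm.aemeasurable (by fun_prop), integral_prod_symm]
  · simp_rw [charFun_apply_real, hin]
    push_cast
    rfl
  · refine Integrable.of_bound ?_ 1 (ae_of_all _ fun p => ?_)
    · exact (Measurable.aestronglyMeasurable (by fun_prop))
    · rw [Complex.norm_exp_ofReal_mul_I]

/-- The gamma transform determines weak convergence: scaling by an independent gamma variable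
turns the transform into a characteristic function, and dividing by the total mass, which is
positive, undoes the scaling. -/
theorem tendsto_of_tendsto_integral_charFun {c : ℝ} (hc : 0 < c)
    {D : ℕ → ProbabilityMeasure (ProbabilityMeasure ℝ)}
    {D₀ : ProbabilityMeasure (ProbabilityMeasure ℝ)}
    (h : ∀ f : BoundedContinuousFunction ℝ ℝ, Tendsto
      (fun N => ∫ P, charFun (gammaLaw c) (∫ x, f x ∂(P : Measure ℝ))
        ∂(D N : Measure (ProbabilityMeasure ℝ))) atTop
      (𝓝 (∫ P, charFun (gammaLaw c) (∫ x, f x ∂(P : Measure ℝ))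
        ∂(D₀ : Measure (ProbabilityMeasure ℝ))))) :
    Tendsto D atTop (𝓝 D₀) := by
  have := isProbabilityMeasure_gammaLaw hc.le
  refine tendsto_of_forall_isIntegralCylinder ?_
  rintro _ ⟨s, U, hU, rfl⟩
  set f : s → BoundedContinuousFunction ℝ ℝ := fun f => f with hf
  have hm := measurable_scaledIntegralVector f
  have hprob : ∀ E : ProbabilityMeasure (ProbabilityMeasure ℝ), IsProbabilityMeasure
      (((gammaLaw c).prod (E : Measure (ProbabilityMeasure ℝ))).map (scaledIntegralVector f)) :=
    fun E => Measure.isProbabilityMeasure_map hm.aemeasurable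
  have hconv : Tendsto (β := ProbabilityMeasure (EuclideanSpace ℝ (Option s)))
      (fun N => ⟨_, hprob (D N)⟩) atTop (𝓝 ⟨_, hprob D₀⟩) := by
    refine ProbabilityMeasure.tendsto_of_tendsto_charFun fun t => ?_
    simp only [ProbabilityMeasure.coe_mk, charFun_map_scaledIntegralVector]
    exact h _
  -- `V` is the open condition on `s • P` that is equivalent, as `s > 0`, to the given one on `P`.
  set V : Set (EuclideanSpace ℝ (Option s)) :=
    {y | 0 < y none ∧ (fun i => y (some i) / y none) ∈ U} with hV_def
  have hV : IsOpen V := by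
    have hpos : IsOpen {y : EuclideanSpace ℝ (Option s) | 0 < y none} :=
      isOpen_lt continuous_const (by fun_prop)
    refine ContinuousOn.isOpen_inter_preimage (t := U)
      (f := fun (y : EuclideanSpace ℝ (Option s)) i => y (some i) / y none) ?_ hpos hU
    refine continuousOn_pi.2 fun i => ContinuousOn.div (by fun_prop) (by fun_prop) fun y hy => ?_
    exact ne_of_gt hy
  have hmeas : ∀ E : ProbabilityMeasure (ProbabilityMeasure ℝ),
      ((gammaLaw c).prod (E : Measure (ProbabilityMeasure ℝ))).map (scaledIntegralVector f) V =
        (E : Measure (ProbabilityMeasure ℝ)) (integralVector f ⁻¹' U) := by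
    intro E
    rw [Measure.map_apply hm hV.measurableSet]
    have hae : (scaledIntegralVector f ⁻¹' V : Set (ℝ × ProbabilityMeasure ℝ))
        =ᵐ[(gammaLaw c).prod (E : Measure (ProbabilityMeasure ℝ))]
        (Set.univ ×ˢ (integralVector f ⁻¹' U) : Set (ℝ × ProbabilityMeasure ℝ)) := by
      filter_upwards [Measure.quasiMeasurePreserving_fst.ae (ae_pos_gammaLaw hc)] with p hp
      refine propext ⟨fun hpV => ⟨trivial, ?_⟩, fun hpU => ⟨hp, ?_⟩⟩
      · have h2 := hpV.2
        simpa [scaledIntegralVector, mul_div_cancel_left₀ _ hp.ne'] using h2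
      · have h2 : integralVector f p.2 ∈ U := hpU.2
        simpa [scaledIntegralVector, mul_div_cancel_left₀ _ hp.ne'] using h2
    rw [measure_congr hae, Measure.prod_prod, measure_univ, one_mul]
  have hle := ProbabilityMeasure.le_liminf_measure_open_of_tendsto hconv hV
  simpa only [ProbabilityMeasure.coe_mk, hmeas] using hle

/-! ### Empirical and spectral measures -/

theorem coe_empiricalMeasure {n : ℕ} (x : Fin (n + 1) → ℝ) :
    (empiricalMeasure x : Measure ℝ) =
      ((n + 1 : ℕ) : ℝ≥0∞)⁻¹ • ∑ i, Measure.dirac (x i) := rfl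

theorem integral_empiricalMeasure {E : Type*} [NormedAddCommGroup E] [NormedSpace ℝ E]
    [CompleteSpace E] {n : ℕ} (x : Fin (n + 1) → ℝ) (φ : ℝ → E) :
    ∫ y, φ y ∂(empiricalMeasure x : Measure ℝ) = ((n + 1 : ℝ))⁻¹ • ∑ i, φ (x i) := by
  rw [coe_empiricalMeasure, integral_smul_measure, integral_finsetSum_measure fun i _ =>
    integrable_dirac (by simp)]
  simp [ENNReal.toReal_add]

theorem measurable_empiricalMeasure {n : ℕ} :
    Measurable (empiricalMeasure : (Fin (n + 1) → ℝ) → ProbabilityMeasure ℝ) := by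
  refine Measurable.subtype_mk (f := fun x => (empiricalMeasure x : Measure ℝ)) ?_
  simp_rw [coe_empiricalMeasure]
  refine Measure.measurable_of_measurable_coe _ fun s hs => ?_
  simp only [Measure.smul_apply, Measure.finsetSum_apply, Measure.dirac_apply' _ hs, smul_eq_mul]
  exact (Finset.measurable_fun_sum _ fun i _ =>
    (measurable_one.indicator hs).comp (measurable_pi_apply i)).const_mul _

theorem coe_spectralMeasure {n : ℕ} {w : Fin n → ℝ} (hw : w ∈ stdSimplex ℝ (Fin n))
    (x : Fin n → ℝ) :
    (spectralMeasure w x : Measure ℝ) = ∑ i, ENNReal.ofReal (w i) • Measure.dirac (x i) := by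
  rw [show spectralMeasure w x = ⟨_, isProbabilityMeasure_sum_smul_dirac hw x⟩ from dif_pos hw]
  rfl

theorem integral_spectralMeasure {n : ℕ} {w : Fin n → ℝ} (hw : w ∈ stdSimplex ℝ (Fin n))
    (x : Fin n → ℝ) (φ : ℝ → ℝ) :
    ∫ y, φ y ∂(spectralMeasure w x : Measure ℝ) = ∑ i, w i * φ (x i) := by
  rw [coe_spectralMeasure hw, integral_finsetSum_measure fun i _ =>
    (integrable_dirac (by simp)).smul_measure ENNReal.ofReal_ne_top]
  simp [integral_smul_measure, ENNReal.toReal_ofReal (hw.1 _)]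

theorem measurable_spectralMeasure {n : ℕ} :
    Measurable fun p : (Fin n → ℝ) × (Fin n → ℝ) => spectralMeasure p.1 p.2 := by
  classical
  refine Measurable.subtype_mk
    (f := fun p : (Fin n → ℝ) × (Fin n → ℝ) => (spectralMeasure p.1 p.2 : Measure ℝ)) ?_
  have hcoe : (fun p : (Fin n → ℝ) × (Fin n → ℝ) => (spectralMeasure p.1 p.2 : Measure ℝ)) =
      fun p => if p.1 ∈ stdSimplex ℝ (Fin n) then
        ∑ i, ENNReal.ofReal (p.1 i) • Measure.dirac (p.2 i) else Measure.dirac 0 := by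
    ext1 p
    by_cases h : p.1 ∈ stdSimplex ℝ (Fin n)
    · rw [if_pos h, coe_spectralMeasure h]
    · rw [if_neg h, show spectralMeasure p.1 p.2 = diracProba 0 from dif_neg h]
      rfl
  rw [hcoe]
  refine Measurable.ite (measurable_fst (isClosed_stdSimplex ℝ (Fin n)).measurableSet) ?_
    measurable_const
  refine Measure.measurable_of_measurable_coe _ fun s hs => ?_
  simp only [Measure.smul_apply, Measure.finsetSum_apply, Measure.dirac_apply' _ hs, smul_eq_mul]
  refine Finset.measurable_fun_sum _ fun i _ => Measurable.mul (by fun_prop) ?_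
  exact (measurable_one.indicator hs).comp (by fun_prop)

/-- The gamma transform of the spectral measure: integrating out the weights leaves a functional of
the empirical measure. -/
theorem integral_charFun_spectralMeasure {Ω : Type*} [MeasurableSpace Ω] {Q : Measure Ω}
    [IsProbabilityMeasure Q] {c : ℝ} (hc : 0 < c) {n : ℕ} {w lam : Ω → Fin (n + 1) → ℝ}
    (hw : HasLaw w (dirichletDistribution fun _ : Fin (n + 1) => c / (n + 1 : ℝ)) Q)
    (hlam : AEMeasurable lam Q) (hind : IndepFun w lam Q) (f : BoundedContinuousFunction ℝ ℝ) :
    ∫ ω, charFun (gammaLaw c) (∫ x, f x ∂(spectralMeasure (w ω) (lam ω) : Measure ℝ)) ∂Q =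
      ∫ ω, Complex.exp (-(c * ∫ x, logSymbol (f x) ∂(empiricalMeasure (lam ω) : Measure ℝ)))
        ∂Q := by
  have := isProbabilityMeasure_gammaLaw hc.le
  set a : Fin (n + 1) → ℝ := fun _ => c / (n + 1 : ℝ) with ha_def
  have hn : (0 : ℝ) < n + 1 := by positivity
  have ha : ∀ i, 0 ≤ a i := fun i => div_nonneg hc.le hn.le
  have hsum : ∑ i, a i = c := by
    simp only [ha_def, Finset.sum_const, Finset.card_univ, Fintype.card_fin, nsmul_eq_mul]
    push_cast
    field_simp
  have hcs : 0 < ∑ i, a i := hsum ▸ hc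
  have := isProbabilityMeasure_dirichletDistribution ha
  have hν := Measure.isProbabilityMeasure_map hlam
  have hjoint := (indepFun_iff_map_prod_eq_prod_map_map hw.aemeasurable hlam).1 hind
  rw [hw.map_eq] at hjoint
  have hcont := continuous_charFun_gammaLaw hc.le
  set Ψ : (Fin (n + 1) → ℝ) × (Fin (n + 1) → ℝ) → ℂ := fun p =>
    charFun (gammaLaw c) (∫ x, f x ∂(spectralMeasure p.1 p.2 : Measure ℝ)) with hΨ
  have hΨm : Measurable Ψ := hcont.measurable.comp
    ((measurable_integral_probabilityMeasure f.continuous.measurable).comp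
      measurable_spectralMeasure)
  have hΦm : Measurable fun x : Fin (n + 1) → ℝ =>
      Complex.exp (-(c * ∫ y, logSymbol (f y) ∂(empiricalMeasure x : Measure ℝ))) := by
    simp_rw [integral_empiricalMeasure]
    have hL : Measurable fun y => logSymbol (f y) :=
      (continuous_logSymbol.comp f.continuous).measurable
    refine Complex.measurable_exp.comp (Measurable.neg (Measurable.const_mul ?_ _))
    exact (Finset.measurable_fun_sum _ fun i _ => hL.comp (measurable_pi_apply i)).const_smul _
  have hint : Integrable Ψ ((dirichletDistribution a).prod (Q.map lam)) :=
    Integrable.of_bound hΨm.aestronglyMeasurable 1 (ae_of_all _ fun p => norm_charFun_le_one _)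
  calc
    _ = ∫ p, Ψ p ∂(dirichletDistribution a).prod (Q.map lam) := by
      rw [← hjoint, integral_map (hw.aemeasurable.prodMk hlam) hΨm.aestronglyMeasurable]
    _ = ∫ x, ∫ d, Ψ (d, x) ∂dirichletDistribution a ∂Q.map lam := integral_prod_symm _ hint
    _ = ∫ x, Complex.exp (-(c * ∫ y, logSymbol (f y) ∂(empiricalMeasure x : Measure ℝ)))
          ∂Q.map lam := by
      refine integral_congr_ae (ae_of_all _ fun x => ?_)
      have hD := integral_charFun_dirichletDistribution ha hcs fun i => f (x i)
      rw [hsum] at hD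
      have hae : (fun d => Ψ (d, x)) =ᵐ[dirichletDistribution a]
          fun d => charFun (gammaLaw c) (∑ i, d i * f (x i)) := by
        filter_upwards [ae_mem_stdSimplex_dirichletDistribution ha hcs] with d hd
        simp only [hΨ, integral_spectralMeasure hd]
      simp only []
      rw [integral_congr_ae hae, hD, integral_empiricalMeasure, Complex.real_smul]
      simp only [ha_def, ← Finset.mul_sum]
      congr 2
      push_cast
      ring
    _ = _ := integral_map hlam hΦm.aestronglyMeasurable

/-- The real and the imaginary part of `logSymbol ∘ f` as bounded continuous functions. -/
theorem exists_boundedContinuous_logSymbol (f : BoundedContinuousFunction ℝ ℝ) :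
    ∃ u v : BoundedContinuousFunction ℝ ℝ, ∀ x, logSymbol (f x) = u x + v x * Complex.I := by
  obtain ⟨C, hC⟩ := exists_norm_logSymbol_le ‖f‖
  have hb : ∀ x, ‖logSymbol (f x)‖ ≤ C := fun x => hC _ (f.norm_coe_le_norm x)
  have hcont : Continuous fun x => logSymbol (f x) := continuous_logSymbol.comp f.continuous
  refine ⟨BoundedContinuousFunction.ofNormedAddCommGroup (fun x => (logSymbol (f x)).re)
    (Complex.continuous_re.comp hcont) C fun x => (Complex.abs_re_le_norm _).trans (hb x),
    BoundedContinuousFunction.ofNormedAddCommGroup (fun x => (logSymbol (f x)).im)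
    (Complex.continuous_im.comp hcont) C fun x => (Complex.abs_im_le_norm _).trans (hb x),
    fun x => (Complex.re_add_im _).symm⟩

theorem integral_logSymbol_eq {f u v : BoundedContinuousFunction ℝ ℝ}
    (h : ∀ x, logSymbol (f x) = u x + v x * Complex.I) (μ : ProbabilityMeasure ℝ) :
    ∫ x, logSymbol (f x) ∂(μ : Measure ℝ) =
      ((∫ x, u x ∂(μ : Measure ℝ) : ℝ) : ℂ) +
        ((∫ x, v x ∂(μ : Measure ℝ) : ℝ) : ℂ) * Complex.I := by
  simp_rw [h]
  rw [integral_add (u.integrable _).ofReal ((v.integrable _).ofReal.mul_const _),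
    integral_mul_const, integral_complex_ofReal, integral_complex_ofReal]

theorem re_logSymbol_nonneg (y : ℝ) : 0 ≤ (logSymbol y).re := by
  rw [logSymbol, Complex.log_re]
  refine Real.log_nonneg ?_
  have := Complex.abs_re_le_norm (1 - y * Complex.I)
  simpa using this

theorem norm_exp_neg_integral_logSymbol_le {c : ℝ} (hc : 0 ≤ c)
    (f : BoundedContinuousFunction ℝ ℝ) (μ : ProbabilityMeasure ℝ) :
    ‖Complex.exp (-(c * ∫ x, logSymbol (f x) ∂(μ : Measure ℝ)))‖ ≤ 1 := by
  obtain ⟨u, v, huv⟩ := exists_boundedContinuous_logSymbol f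
  rw [integral_logSymbol_eq huv, Complex.norm_exp, Real.exp_le_one_iff]
  have hu : 0 ≤ ∫ x, u x ∂(μ : Measure ℝ) := integral_nonneg fun x => by
    have := re_logSymbol_nonneg (f x)
    simpa [huv] using this
  simpa using mul_nonneg hc hu

/-- Bounded convergence in probability: the measures `ξ N` enter only through the integrals of the
real and the imaginary part of `log (1 - i f)`. -/
theorem tendsto_integral_exp_logSymbol {Ω : ℕ → Type*} [∀ N, MeasurableSpace (Ω N)]
    {Q : ∀ N, Measure (Ω N)} [∀ N, IsProbabilityMeasure (Q N)]
    {ξ : ∀ N, Ω N → ProbabilityMeasure ℝ} {ρ : ProbabilityMeasure ℝ}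
    (hξm : ∀ N, AEMeasurable (ξ N) (Q N)) (hξ : TendstoWeaklyInProbability ξ ρ Q)
    {c : ℝ} (hc : 0 ≤ c) (f : BoundedContinuousFunction ℝ ℝ) :
    Tendsto (fun N => ∫ ω, Complex.exp (-(c * ∫ x, logSymbol (f x) ∂(ξ N ω : Measure ℝ))) ∂Q N)
      atTop (𝓝 (Complex.exp (-(c * ∫ x, logSymbol (f x) ∂(ρ : Measure ℝ))))) := by
  obtain ⟨u, v, huv⟩ := exists_boundedContinuous_logSymbol f
  set J : BoundedContinuousFunction ℝ ℝ → ProbabilityMeasure ℝ → ℝ :=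
    fun g μ => ∫ x, g x ∂(μ : Measure ℝ) with hJ
  set E : ℝ × ℝ → ℂ := fun p => Complex.exp (-(c * (p.1 + p.2 * Complex.I))) with hE
  have hEc : Continuous E := by fun_prop
  have hEJ : ∀ μ : ProbabilityMeasure ℝ,
      Complex.exp (-(c * ∫ x, logSymbol (f x) ∂(μ : Measure ℝ))) = E (J u μ, J v μ) :=
    fun μ => by rw [integral_logSymbol_eq huv]
  have hbound : ∀ μ : ProbabilityMeasure ℝ, ‖E (J u μ, J v μ)‖ ≤ 1 := fun μ => by
    rw [← hEJ]; exact norm_exp_neg_integral_logSymbol_le hc f μ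
  simp_rw [hEJ]
  have hEm : ∀ N, AEMeasurable (fun ω => E (J u (ξ N ω), J v (ξ N ω))) (Q N) := fun N =>
    hEc.measurable.comp_aemeasurable
      (((measurable_integral_probabilityMeasure u.continuous.measurable).comp_aemeasurable
        (hξm N)).prodMk
      ((measurable_integral_probabilityMeasure v.continuous.measurable).comp_aemeasurable
        (hξm N)))
  rw [tendsto_iff_norm_sub_tendsto_zero]
  refine (ENNReal.tendsto_toReal_zero_iff (f := fun N => ENNReal.ofReal
    ‖∫ ω, E (J u (ξ N ω), J v (ξ N ω)) ∂Q N - E (J u ρ, J v ρ)‖)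
    fun _ => ENNReal.ofReal_ne_top).2 ?_ |>.congr fun N => ENNReal.toReal_ofReal (norm_nonneg _)
  rw [ENNReal.tendsto_nhds_zero]
  intro ε hε
  obtain ⟨η, hη, hηε⟩ : ∃ η : ℝ, 0 < η ∧ ENNReal.ofReal η ≤ ε / 2 := by
    rcases eq_or_ne ε ∞ with rfl | hfin
    · exact ⟨1, one_pos, by simp [ENNReal.top_div]⟩
    · refine ⟨(ε / 2).toReal, ENNReal.toReal_pos (ENNReal.half_pos hε.ne').ne' ?_, ?_⟩
      · exact ENNReal.div_ne_top hfin (by simp)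
      · exact ENNReal.ofReal_toReal_le
  -- `E` is continuous at the limit point, and bounded by `1` on the values that occur.
  obtain ⟨δ, hδ, hδE⟩ := Metric.continuousAt_iff.1 (hEc.continuousAt (x := (J u ρ, J v ρ))) η hη
  set B : BoundedContinuousFunction ℝ ℝ → ∀ N, Set (Ω N) := fun g N =>
    {ω | δ ≤ |J g (ξ N ω) - J g ρ|} with hB
  have hBu : Tendsto (fun N => Q N (B u N)) atTop (𝓝 0) := hξ u δ hδ
  have hBv : Tendsto (fun N => Q N (B v N)) atTop (𝓝 0) := hξ v δ hδ
  have hsum : Tendsto (fun N => 2 * (Q N (B u N) + Q N (B v N))) atTop (𝓝 0) := by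
    simpa using ENNReal.Tendsto.const_mul (hBu.add hBv) (Or.inr (by simp : (2 : ℝ≥0∞) ≠ ∞))
  filter_upwards [ENNReal.tendsto_nhds_zero.1 hsum (ε / 2) (ENNReal.half_pos hε.ne')] with N hN
  have hint : Integrable (fun ω => E (J u (ξ N ω), J v (ξ N ω))) (Q N) :=
    Integrable.of_bound (hEm N).aestronglyMeasurable 1 (ae_of_all _ fun ω => hbound _)
  have hdiff : ∫ ω, E (J u (ξ N ω), J v (ξ N ω)) ∂Q N - E (J u ρ, J v ρ) =
      ∫ ω, (E (J u (ξ N ω), J v (ξ N ω)) - E (J u ρ, J v ρ)) ∂Q N := by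
    rw [integral_sub hint (integrable_const _)]
    simp
  rw [hdiff, ofReal_norm]
  refine (enorm_integral_le_lintegral_enorm _).trans ?_
  -- The bad set is enlarged to a measurable set of the same measure.
  set B' := toMeasurable (Q N) (B u N ∪ B v N) with hB'
  have hB'm : MeasurableSet B' := measurableSet_toMeasurable _ _
  have hpt : ∀ ω, ‖E (J u (ξ N ω), J v (ξ N ω)) - E (J u ρ, J v ρ)‖ₑ ≤
      ENNReal.ofReal η + B'.indicator (fun _ => 2) ω := by
    intro ω
    by_cases hω : ω ∈ B'
    · rw [Set.indicator_of_mem hω]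
      refine le_add_left ?_
      rw [← ofReal_norm, ← ENNReal.ofReal_ofNat 2]
      refine ENNReal.ofReal_le_ofReal ((norm_sub_le _ _).trans ?_)
      linarith [hbound (ξ N ω), hbound ρ]
    · have hω' : ω ∉ B u N ∪ B v N := fun h' => hω (subset_toMeasurable _ _ h')
      rw [Set.mem_union, not_or] at hω'
      rw [Set.indicator_of_notMem hω, add_zero, ← ofReal_norm, ← dist_eq_norm]
      refine ENNReal.ofReal_le_ofReal (hδE ?_).le
      rw [Prod.dist_eq, max_lt_iff]
      exact ⟨not_le.1 hω'.1, not_le.1 hω'.2⟩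
  calc
    _ ≤ ∫⁻ ω, ENNReal.ofReal η + B'.indicator (fun _ => 2) ω ∂Q N := lintegral_mono hpt
    _ = ENNReal.ofReal η + 2 * Q N (B u N ∪ B v N) := by
      rw [lintegral_add_left measurable_const, lintegral_indicator_const hB'm, hB',
        measure_toMeasurable]
      simp
    _ ≤ ε / 2 + ε / 2 := by
      refine add_le_add hηε (le_trans ?_ hN)
      gcongr
      exact measure_union_le _ _
    _ = ε := ENNReal.add_halves ε

/-! ### The limit theorem -/

/-- For the system size `N + 1`, `N = 0, 1, 2, …`, the weights are `w N` and the points `lam N`. The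
conclusion has two parts: the limit exists as a Dirichlet process on some probability space (the
space of probability measures on the line, with the identity map), and the random probability
measures converge in distribution, for the weak topology, to any such process. -/
theorem theorem1p1 {Ω : ℕ → Type*} [∀ N, MeasurableSpace (Ω N)]
    (Q : ∀ N, Measure (Ω N)) [∀ N, IsProbabilityMeasure (Q N)]
    (c : ℝ) (hc : 0 < c)
    (w lam : ∀ N, Ω N → Fin (N + 1) → ℝ)
    (hw : ∀ N, HasLaw (w N) (dirichletDistribution fun _ : Fin (N + 1) => c / (N + 1 : ℝ)) (Q N))
    (hlam : ∀ N, AEMeasurable (lam N) (Q N))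
    (hwlam : ∀ N, IndepFun (w N) (lam N) (Q N))
    (ρ : ProbabilityMeasure ℝ)
    (hρ : TendstoWeaklyInProbability (fun N ω => empiricalMeasure (lam N ω)) ρ Q) :
    (∃ D : Measure (ProbabilityMeasure ℝ),
      IsProbabilityMeasure D ∧ IsDirichletProcess id ρ c D) ∧
    ∀ (Ω' : Type*) [MeasurableSpace Ω'] (Q' : Measure Ω') [IsProbabilityMeasure Q']
      (P : Ω' → ProbabilityMeasure ℝ), IsDirichletProcess P ρ c Q' →
      TendstoInDistribution (fun N ω => spectralMeasure (w N ω) (lam N ω)) atTop P Q Q' := by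
  refine ⟨exists_isDirichletProcess ρ hc, fun Ω' _ Q' _ P hP => ?_⟩
  have hsm : ∀ N, AEMeasurable (fun ω => spectralMeasure (w N ω) (lam N ω)) (Q N) := fun N =>
    measurable_spectralMeasure.comp_aemeasurable ((hw N).aemeasurable.prodMk (hlam N))
  have hm : ∀ f : BoundedContinuousFunction ℝ ℝ, Measurable fun P : ProbabilityMeasure ℝ =>
      charFun (gammaLaw c) (∫ x, f x ∂(P : Measure ℝ)) := fun f =>
    (continuous_charFun_gammaLaw hc.le).measurable.comp
      (measurable_integral_probabilityMeasure f.continuous.measurable)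
  refine ⟨hsm, hP.aemeasurable, tendsto_of_tendsto_integral_charFun hc fun f => ?_⟩
  simp only [ProbabilityMeasure.coe_mk]
  rw [integral_map hP.aemeasurable (hm f).aestronglyMeasurable, hP.integral_charFun hc f]
  refine (tendsto_integral_exp_logSymbol
    (fun N => measurable_empiricalMeasure.comp_aemeasurable (hlam N)) hρ hc.le f).congr fun N => ?_
  rw [integral_map (hsm N) (hm f).aestronglyMeasurable]
  exact (integral_charFun_spectralMeasure hc (hw N) (hlam N) (hwlam N) f).symm
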